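/- **Games.** There are two players, $\top$ (machine) and $\bot$ (environment); $\neg\wp$ is the adversary of $\wp$. A move is a finite string over the keyboard alphabet, a labmove is a move labeled by a player, a run is a finite or infinite sequence of labmoves, and $\neg\Gamma$ is $\Gamma$ with all labels switched. A constant game $A$ consists of a set $\mathbf{Lr}^A$ of (legal) runs, such that a run is legal iff all its nonempty finite initial segments are, and a function $\mathbf{Wn}^A$ from runs to $\{\top,\bot\}$ such that $\mathbf{Wn}^A\langle\Gamma\rangle=\neg\wp$ whenever $\Gamma$ is $\wp$-illegal, i.e. the last move of the shortest illegal initial segment of $\Gamma$ is $\wp$-labeled. So $\mathbf{Wn}^A$ only has to be specified on legal runs. A run $\Upsilon$ is a $\wp$-delay of $\Gamma$ if both have the same subsequence of moves of each player and, whenever the $n$-th $\wp$-labeled move is later than the $k$-th $\neg\wp$-labeled one in $\Gamma$, so is it in $\Upsilon$. $A$ is static if for every $\wp$ and every $\wp$-delay $\Upsilon$ of $\Gamma$: if $\Gamma$ is not $\wp$-illegal then neither is $\Upsilon$, and if $\mathbf{Wn}^A\langle\Gamma\rangle=\wp$ then $\mathbf{Wn}^A\langle\Upsilon\rangle=\wp$.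 **Operations.** For a string $\alpha$, $\Gamma^{\alpha}$ is obtained from $\Gamma$ by deleting all labmoves except those with moves of the form $\alpha\beta$ and removing the prefix $\alpha$ from these. For infinite bitstrings $x$ and $x_1,\dots,x_n$, $\Gamma^{\preceq x}$ and $\Gamma^{\preceq a;x_1,\dots,x_n}$ are obtained likewise by keeping the moves $u.\beta$ with $u$ a finite prefix of $x$, respectively the moves $a;u_1,\dots,u_n.\beta$ with each $u_j$ a finite prefix of $x_j$ ($a$ written as a decimal numeral), and reducing them to $\beta$. On constant games: - $\neg A$: $\Gamma$ is legal iff $\neg\Gamma\in\mathbf{Lr}^A$; a legal $\Gamma$ is won by $\top$ iff $\mathbf{Wn}^A\langle\neg\Gamma\rangle=\bot$. - $A_0\wedge A_1$ and $A_0\vee A_1$: $\Gamma$ is legal iff each of its moves is of the form $i.\alpha$ with $i\in\{0,1\}$ and $\Gamma^{i.}\in\mathbf{Lr}^{A_i}$ for both $i$; a legal $\Gamma$ is won by $\top$ iff $\mathbf{Wn}^{A_i}\langle\Gamma^{i.}\rangle=\top$ for both $i$, respectively for some $i$. - Branching recurrence and branching corecurrence of $A$: $\Gamma$ is legal iff each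 of its moves is of the form $w.\alpha$ with $w$ a finite bitstring and $\Gamma^{\preceq x}\in\mathbf{Lr}^A$ for all infinite bitstrings $x$; a legal $\Gamma$ is won by $\top$ iff $\mathbf{Wn}^A\langle\Gamma^{\preceq x}\rangle=\top$ for all $x$, respectively for some $x$. **Formulas and cirquents.** Formulas are built from atoms and negated atoms by $\wedge,\vee$, recurrence and corecurrence. A constant interpretation $^*$ sends every atom to a static constant game; it extends to all formulas through the operations of the same names. A cirquent $C$ has formulas $F_1,\dots,F_k$ (its oformulas), undergroups $U_1,\dots,U_m$ and overgroups $O_1,\dots,O_n$ ($k,m,n\ge1$); the groups are nonempty sets of oformulas, and each oformula is in at least one undergroup and at least one overgroup. In the constant game $C^*$, $\Gamma$ is legal iff each of its moves is of the form $a;u_1,\dots,u_n.\alpha$ with $1\le a\le k$, finite bitstrings $u_j$, and $u_j$ empty whenever $F_a\notin O_j$, and moreover $\Gamma^{\preceq a;\vec x}\in\mathbf{Lr}^{F_a^*}$ for all $a$ and all sequences $\vec x$ of $n$ infinite bitstrings; a legal $\Gamma$ is won by $\top$ iff for every $i$ and every $\vec x$ there is an $F_a\in U_i$ with $\mathbf{Wn}^{F_a^*}\langle\Gamma^{\preceq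 a;\vec x}\rangle=\top$. For a formula $F$, $F^\clubsuit$ is the cirquent $(\langle F\rangle,\langle\{F\}\rangle,\langle\{F\}\rangle)$. **Machines.** A machine is a deterministic Turing machine, given by a finite transition table, with finitely many read/write work tapes, a read-only run tape that at any time spells the sequence of all labmoves made so far, and a read-only valuation tape that spells a valuation $e$ (a function from the variables $v_0,v_1,\dots$ to natural numbers) as the list $e(v_0),e(v_1),\dots$; in addition it can make moves, typing them key by key. It is of one of three kinds. A hard-play machine (HPM) makes at most one move per clock cycle, and on each cycle the environment may make any finite number of moves. An easy-play machine (EPM) makes at most one move per cycle, and the environment may make at most one move on a cycle on which the machine grants permission, and none on other cycles. A block-move EPM is like an EPM, but each player can make any finite number of moves at once. Moves of the environment precede those of the machine on the same cycle. An $e$-computation branch is an infinite sequence of configurations that starts in the initial configuration on $e$ and in which each further configuration is a possible successor of the previous one (a halted machine stays as it is); it spells a run on the run tape. The machine wins the constant game $A$ if, for every valuation $e$, the run $\Gamma$ spelled by any $e$-computation branch $B$ satisfies $\mathbf{Wn}^A\langle\Gamma\rangle=\top$ and, for the two easy-play kinds, permission is granted infinitely often in $B$ unless $\Gamma$ is a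 $\bot$-illegal run of $A$. **Lemma.** Fix a collection of atoms. There is an effective (computable with respect to the standard coding of machines by natural numbers) function $g$ from machines to machines such that, for every machine $\mathcal M$, every formula $F$ and every constant interpretation $^*$: if $\mathcal M$ wins $(F^\clubsuit)^*$, then $g(\mathcal M)$ wins $F^*$. -/

import Mathlib

universe u

namespace CoL

/-! ### Players, moves, runs -/

/-- The two players: the machine `top` and the environment `bot`. -/
inductive Player where
  | top
  | bot
  deriving DecidableEq

/-- The adversary of a player. -/
def Player.adv : Player → Player
  | .top => .bot
  | .bot => .top

theorem Player.adv_adv (p : Player) : p.adv.adv = p := by cases p <;> rfl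

/-- The keyboard alphabet: the 95 printable ASCII characters, the character with ASCII code `c`
being the element `c - 32`. -/
abbrev Key : Type := Fin 95

/-- The key of the decimal digit `d` (ASCII code `48 + d`), for `d < 10`. -/
def digitKey (d : ℕ) : Key := Fin.ofNat 95 (16 + d)

/-- The period (ASCII 46). -/
def dotKey : Key := 14

/-- The semicolon (ASCII 59). -/
def semicolonKey : Key := 27

/-- The comma (ASCII 44). -/
def commaKey : Key := 12

/-- The decimal numeral of a natural number. -/
def numeral (n : ℕ) : List Key :=
  if n = 0 then [digitKey 0] else ((Nat.digits 10 n).map digitKey).reverse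

/-- A finite bitstring as a string of the keys `0` and `1`. -/
def bitKeys (w : List Bool) : List Key := w.map fun b => digitKey (if b then 1 else 0)

/-- Moves: finite strings over the keyboard alphabet. -/
abbrev Move : Type := List Key

/-- Labeled moves. -/
abbrev LabMove : Type := Player × Move

/-- Positions: finite runs. -/
abbrev Position : Type := List LabMove

/-- Runs: finite or infinite sequences of labeled moves. -/
abbrev Run : Type := Stream'.Seq LabMove

/-- A position seen as a run. -/
def Position.toRun (Φ : Position) : Run := Stream'.Seq.ofList Φ

/-- The limit of a sequence of finite lists each of which is an initial segment of the next one: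
its `n`-th element is the `n`-th element of the first list of the sequence that has one. -/
noncomputable def listLimit {α : Type*} (c : ℕ → List α) : Stream'.Seq α := by
  classical
  exact ⟨fun n => if h : ∃ t, n < (c t).length then (c (Nat.find h))[n]? else none, by
    intro n hn
    have hno : ¬ ∃ t, n < (c t).length := by
      intro h
      have hn' : (if h : ∃ t, n < (c t).length then (c (Nat.find h))[n]? else none)
          = none := hn
      rw [dif_pos h] at hn'
      have := Nat.find_spec h
      rw [List.getElem?_eq_none_iff] at hn'
      omega
    have hno' : ¬ ∃ t, n + 1 < (c t).length := fun ⟨t, ht⟩ => hno ⟨t, by omega⟩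
    exact dif_neg hno'⟩

/-- The result of deleting from a run the labmoves `x` with `f x = none` and replacing every other
labmove `x` by the value of `f x`. -/
noncomputable def filterMap {α β : Type*} (f : α → Option β) (s : Stream'.Seq α) :
    Stream'.Seq β :=
  listLimit fun n => (s.take n).filterMap f

/-- The run with every label changed to the opposite one. -/
def Run.neg (Γ : Run) : Run := Stream'.Seq.map (fun x => (x.1.adv, x.2)) Γ

open Classical in
/-- For a move of the form `p β` with `p ∈ S`, the move `β`; otherwise nothing. It is only used
with sets `S` none of whose elements is a proper initial segment of another one, so that `p` and
`β` are unique. -/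
noncomputable def stripPrefix (S : Set Move) (m : Move) : Option Move :=
  if h : ∃ β, ∃ p ∈ S, m = p ++ β then some h.choose else none

/-- The result of deleting from a run all labmoves except those whose moves look like `p β` with
`p ∈ S`, and then deleting the prefix `p` from these moves. -/
noncomputable def Run.restrict (S : Set Move) (Γ : Run) : Run :=
  filterMap (fun x => (stripPrefix S x.2).map fun β => (x.1, β)) Γ

/-! ### Constant games -/

/-- The first illegal move of the run (relative to the set `L` of legal runs) is made by `p`: the
shortest initial segment that is not in `L` ends in a `p`-labeled move. -/
def IllegalBy (L : Set Run) (p : Player) (Γ : Run) : Prop :=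
  ∃ n α, Γ.get? n = some (p, α) ∧ Position.toRun (Γ.take (n + 1)) ∉ L ∧
    ∀ m ≤ n, Position.toRun (Γ.take m) ∈ L

/-- A run is in `L` iff all its nonempty finite initial segments are. -/
def LegalSet (L : Set Run) : Prop :=
  ∀ Γ : Run, Γ ∈ L ↔ ∀ n, Γ.take n ≠ [] → Position.toRun (Γ.take n) ∈ L

/-- Constant games. -/
structure ConstGame where
  /-- the legal runs -/
  Lr : Set Run
  /-- the winner of a run -/
  Wn : Run → Player
  legal : LegalSet Lr
  illegal_lost : ∀ p Γ, IllegalBy Lr p Γ → Wn Γ = p.adv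

/-- `Γ` is a `p`-illegal run of `A`. -/
def ConstGame.Illegal (A : ConstGame) (p : Player) (Γ : Run) : Prop := IllegalBy A.Lr p Γ

theorem LegalSet.iff_take {L : Set Run} (hL : LegalSet L) (Γ : Run) :
    Γ ∈ L ↔ ∀ n, Position.toRun (Γ.take n) ∈ L := by
  have hnil : Position.toRun [] ∈ L := by
    rw [hL]
    intro n hn
    exact absurd (by cases n <;> simp [Position.toRun]) hn
  rw [hL]
  constructor
  · intro h n
    by_cases hn : Γ.take n = []
    · rw [hn]; exact hnil
    · exact h n hn
  · intro h n _
    exact h n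

theorem IllegalBy.not_mem {L : Set Run} (hL : LegalSet L) {p : Player} {Γ : Run}
    (h : IllegalBy L p Γ) : Γ ∉ L := by
  obtain ⟨n, α, _, h2, _⟩ := h
  intro hΓ
  exact h2 ((hL.iff_take Γ).1 hΓ (n + 1))

theorem IllegalBy.unique {L : Set Run} {p q : Player} {Γ : Run}
    (hp : IllegalBy L p Γ) (hq : IllegalBy L q Γ) : p = q := by
  obtain ⟨n, α, h1, h2, h3⟩ := hp
  obtain ⟨m, β, k1, k2, k3⟩ := hq
  have : n = m := by
    rcases lt_trichotomy n m with h | h | h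
    · exact absurd (k3 (n + 1) h) h2
    · exact h
    · exact absurd (h3 (m + 1) h) k2
  subst this
  rw [h1] at k1
  simpa using congrArg (Option.map Prod.fst) k1

open Classical in
/-- The constant game with the given legal runs in which a legal run is won by `top` iff it
satisfies `W`. -/
noncomputable def ConstGame.ofLegal (L : Set Run) (hL : LegalSet L) (W : Run → Prop) :
    ConstGame where
  Lr := L
  Wn Γ :=
    if Γ ∈ L then (if W Γ then .top else .bot)
    else if IllegalBy L .top Γ then .bot else .top
  legal := hL
  illegal_lost := by
    intro p Γ h
    rw [if_neg (h.not_mem hL)]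
    cases p with
    | top => rw [if_pos h]; rfl
    | bot =>
      rw [if_neg]
      · rfl
      · intro h'
        cases h.unique h'

/-! ### Closure of the legality condition -/

theorem toRun_get? (Φ : Position) (n : ℕ) : (Position.toRun Φ).get? n = Φ[n]? := by
  simp [Position.toRun]

theorem getElem?_take {α : Type*} (s : Stream'.Seq α) (n i : ℕ) :
    (s.take n)[i]? = if i < n then s.get? i else none := by
  induction n generalizing s i with
  | zero => simp
  | succ n ih =>
    rcases h : s.destruct with _ | ⟨a, t⟩
    · have hs := Stream'.Seq.destruct_eq_none h
      subst hs
      simp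
    · have hs := Stream'.Seq.destruct_eq_cons h
      subst hs
      cases i with
      | zero => simp
      | succ i => simp [ih]

theorem take_prefix {α : Type*} (s : Stream'.Seq α) {m n : ℕ} (h : m ≤ n) :
    s.take m <+: s.take n := by
  have : s.take m = (s.take n).take m := by
    apply List.ext_getElem?
    intro i
    rw [List.getElem?_take, getElem?_take, getElem?_take]
    split_ifs <;> first | rfl | omega
  rw [this]
  exact List.take_prefix _ _

theorem listLimit_get? {α : Type*} {c : ℕ → List α} (hc : ∀ {m n}, m ≤ n → c m <+: c n)
    {t n : ℕ} (h : n < (c t).length) : (listLimit c).get? n = (c t)[n]? := by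
  classical
  have hex : ∃ t, n < (c t).length := ⟨t, h⟩
  have h1 : (listLimit c).get? n = (c (Nat.find hex))[n]? := dif_pos hex
  rw [h1]
  have hp := hc (Nat.find_min' hex h)
  have hl := Nat.find_spec hex
  obtain ⟨r, hr⟩ := hp
  rw [← hr, List.getElem?_append_left hl]

theorem listLimit_get?_none {α : Type*} {c : ℕ → List α} {n : ℕ}
    (h : ∀ t, (c t).length ≤ n) : (listLimit c).get? n = none := by
  have hno : ¬ ∃ t, n < (c t).length := fun ⟨t, ht⟩ => by have := h t; omega
  exact dif_neg hno

theorem take_listLimit {α : Type*} {c : ℕ → List α} (hc : ∀ {m n}, m ≤ n → c m <+: c n)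
    (t : ℕ) : (listLimit c).take (c t).length = c t := by
  apply List.ext_getElem?
  intro i
  rw [getElem?_take]
  split_ifs with h
  · exact listLimit_get? hc h
  · rw [eq_comm, List.getElem?_eq_none_iff]; omega

theorem exists_take_listLimit {α : Type*} {c : ℕ → List α}
    (hc : ∀ {m n}, m ≤ n → c m <+: c n) (k : ℕ) :
    ∃ t, (listLimit c).take k = (c t).take k := by
  by_cases h : ∃ t, k ≤ (c t).length
  · obtain ⟨t, ht⟩ := h
    refine ⟨t, List.ext_getElem? fun i => ?_⟩
    rw [getElem?_take, List.getElem?_take]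
    split_ifs with hi
    · exact listLimit_get? hc (by omega)
    · rfl
  · push Not at h
    have hb : ∃ t, ∀ s, (c s).length ≤ (c t).length := by
      have hfin : (Set.range fun s => (c s).length).Finite :=
        (Set.finite_lt_nat k).subset (by rintro _ ⟨s, rfl⟩; exact h s)
      obtain ⟨_, ⟨t, rfl⟩, ht⟩ := hfin.exists_maximal (Set.range_nonempty _)
      exact ⟨t, fun s => by
        rcases le_total (c s).length (c t).length with h' | h'
        · exact h'
        · exact ht ⟨s, rfl⟩ h'⟩
    obtain ⟨t, ht⟩ := hb
    refine ⟨t, List.ext_getElem? fun i => ?_⟩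
    rw [getElem?_take, List.getElem?_take]
    split_ifs with hi
    · by_cases hi' : i < (c t).length
      · exact listLimit_get? hc hi'
      · rw [listLimit_get?_none (fun s => (ht s).trans (by omega)), eq_comm,
          List.getElem?_eq_none_iff]
        omega
    · rfl

theorem toRun_take (Φ : Position) (k : ℕ) : (Position.toRun Φ).take k = Φ.take k := by
  apply List.ext_getElem?
  intro i
  rw [getElem?_take, List.getElem?_take, toRun_get?]

theorem filterMap_mono (f : LabMove → Option LabMove) (Γ : Run) {m n : ℕ} (h : m ≤ n) :
    (Γ.take m).filterMap f <+: (Γ.take n).filterMap f :=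
  (take_prefix Γ h).filterMap f

theorem filterMap_toRun (f : LabMove → Option LabMove) (Φ : Position) :
    filterMap f (Position.toRun Φ) = Position.toRun (Φ.filterMap f) := by
  have hle : ∀ n, ((Position.toRun Φ).take n).filterMap f <+: Φ.filterMap f := by
    intro n
    rw [toRun_take]
    exact (List.take_prefix n Φ).filterMap f
  apply Stream'.Seq.ext
  intro n
  rw [toRun_get?]
  by_cases h : n < (Φ.filterMap f).length
  · have hΦ : (((Position.toRun Φ).take Φ.length).filterMap f) = Φ.filterMap f := by
      rw [toRun_take, List.take_length]
    have := listLimit_get? (c := fun n => ((Position.toRun Φ).take n).filterMap f)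
      (filterMap_mono f _) (t := Φ.length) (n := n) (by rw [hΦ]; exact h)
    rw [hΦ] at this
    exact this
  · rw [List.getElem?_eq_none (by omega)]
    exact listLimit_get?_none fun t => (hle t).length_le.trans (by omega)

theorem LegalSet.filterMap {L : Set Run} (hL : LegalSet L) (f : LabMove → Option LabMove) :
    ∀ Γ : Run, filterMap f Γ ∈ L ↔
      ∀ n, CoL.filterMap f (Position.toRun (Γ.take n)) ∈ L := by
  intro Γ
  rw [hL.iff_take]
  constructor
  · intro h n
    rw [filterMap_toRun]
    have := h ((Γ.take n).filterMap f).length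
    rwa [CoL.filterMap, take_listLimit (filterMap_mono f Γ) n] at this
  · intro h k
    obtain ⟨t, ht⟩ := exists_take_listLimit (filterMap_mono f Γ) k
    have h1 := h t
    rw [filterMap_toRun, hL.iff_take] at h1
    have h2 := h1 k
    rw [toRun_take] at h2
    rwa [CoL.filterMap, ht]

theorem legalSet_of_iff {L : Set Run} (h0 : Position.toRun [] ∈ L)
    (h : ∀ Γ : Run, Γ ∈ L ↔ ∀ n, Position.toRun (Γ.take n) ∈ L) : LegalSet L := by
  intro Γ
  rw [h]
  constructor
  · intro h' n _
    exact h' n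
  · intro h' n
    by_cases hn : Γ.take n = []
    · rw [hn]; exact h0
    · exact h' n hn

/-- Every move of the run has the property `Q`. -/
def AllMoves (Q : Move → Prop) (Γ : Run) : Prop :=
  ∀ n x, Γ.get? n = some x → Q x.2

theorem allMoves_iff (Q : Move → Prop) (Γ : Run) :
    AllMoves Q Γ ↔ ∀ n, AllMoves Q (Position.toRun (Γ.take n)) := by
  constructor
  · intro h n i x hx
    rw [toRun_get?, getElem?_take] at hx
    split_ifs at hx
    exact h i x hx
  · intro h n x hx
    refine h (n + 1) n x ?_
    rw [toRun_get?, getElem?_take, if_pos (by omega), hx]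

/-- The form of all the legality conditions below: every move has some property, and each of a
family of restrictions of the run is legal in the respective game. -/
theorem legalSet_restrict {ι : Sort*} (Q : Move → Prop) (S : ι → Set Move) (A : ι → ConstGame) :
    LegalSet {Γ | AllMoves Q Γ ∧ ∀ i, Γ.restrict (S i) ∈ (A i).Lr} := by
  apply legalSet_of_iff
  · refine ⟨fun n x hx => by simp [toRun_get?] at hx, fun i => ?_⟩
    rw [Run.restrict, filterMap_toRun, (A i).legal.iff_take]
    intro n
    rw [toRun_take]
    have h := (A i).legal (Position.toRun [])
    have h' : Position.toRun [] ∈ (A i).Lr := h.2 fun n hn => by simp [toRun_take] at hn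
    simpa using h'
  · intro Γ
    simp only [Set.mem_ofPred_eq]
    rw [allMoves_iff]
    simp only [Run.restrict]
    constructor
    · intro h n
      exact ⟨h.1 n, fun i => (((A i).legal.filterMap _ Γ).1 (h.2 i)) n⟩
    · intro h
      exact ⟨fun n => (h n).1, fun i => ((A i).legal.filterMap _ Γ).2 fun n => (h n).2 i⟩

theorem neg_take (Γ : Run) (n : ℕ) :
    Run.neg (Position.toRun (Γ.take n)) = Position.toRun (Γ.neg.take n) := by
  apply Stream'.Seq.ext
  intro i
  rw [Run.neg, Stream'.Seq.map_get?, toRun_get?, toRun_get?, getElem?_take, getElem?_take,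
    Run.neg, Stream'.Seq.map_get?]
  split_ifs <;> rfl

theorem legalSet_neg (A : ConstGame) : LegalSet {Γ | Γ.neg ∈ A.Lr} := by
  apply legalSet_of_iff
  · have h := neg_take (Position.toRun []) 0
    have h' := (A.legal (Position.toRun [])).2 fun n hn => by simp [toRun_take] at hn
    have h1 : (Position.toRun []).take 0 = [] := rfl
    rw [h1] at h
    change Run.neg (Position.toRun []) ∈ A.Lr
    rw [h]
    exact h'
  · intro Γ
    simp only [Set.mem_ofPred_eq, neg_take]
    exact A.legal.iff_take _

/-! ### Game operations -/

/-- Infinite bitstrings. -/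
abbrev InfBits : Type := ℕ → Bool

/-- The finite bitstring `w` is an initial segment of `x`. -/
def IsInitial (w : List Bool) (x : InfBits) : Prop :=
  ∀ i, ∀ h : i < w.length, w[i] = x i

/-- The string `i.` for `i = 0` (`false`) and `i = 1` (`true`). -/
def sidePrefix (i : Bool) : Move := bitKeys [i] ++ [dotKey]

/-- The strings `w.` with `w` a finite initial segment of `x`. -/
def threadPrefixes (x : InfBits) : Set Move :=
  {p | ∃ w, IsInitial w x ∧ p = bitKeys w ++ [dotKey]}

namespace ConstGame

/-- Negation. -/
noncomputable def neg (A : ConstGame) : ConstGame :=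
  ofLegal {Γ | Γ.neg ∈ A.Lr} (legalSet_neg A) fun Ω => A.Wn Ω.neg = .bot

/-- The legal runs of both parallel combinations of `A false` and `A true`. -/
def parLegal (A : Bool → ConstGame) : Set Run :=
  {Γ | AllMoves (fun m => ∃ i α, m = sidePrefix i ++ α) Γ ∧
    ∀ i, Γ.restrict {sidePrefix i} ∈ (A i).Lr}

/-- Parallel conjunction. -/
noncomputable def and (A₀ A₁ : ConstGame) : ConstGame :=
  let A : Bool → ConstGame := fun i => if i then A₁ else A₀
  ofLegal (parLegal A) (legalSet_restrict _ _ A)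
    fun Ω => ∀ i, (A i).Wn (Ω.restrict {sidePrefix i}) = .top

/-- Parallel disjunction. -/
noncomputable def or (A₀ A₁ : ConstGame) : ConstGame :=
  let A : Bool → ConstGame := fun i => if i then A₁ else A₀
  ofLegal (parLegal A) (legalSet_restrict _ _ A)
    fun Ω => ∃ i, (A i).Wn (Ω.restrict {sidePrefix i}) = .top

/-- The legal runs of both the branching recurrence and the branching corecurrence of `A`. -/
def recLegal (A : ConstGame) : Set Run :=
  {Γ | AllMoves (fun m => ∃ w α, m = bitKeys w ++ [dotKey] ++ α) Γ ∧
    ∀ x : InfBits, Γ.restrict (threadPrefixes x) ∈ A.Lr}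

/-- Branching recurrence. -/
noncomputable def brec (A : ConstGame) : ConstGame :=
  ofLegal (recLegal A) (legalSet_restrict _ _ fun _ : InfBits => A)
    fun Ω => ∀ x : InfBits, A.Wn (Ω.restrict (threadPrefixes x)) = .top

/-- Branching corecurrence. -/
noncomputable def cobrec (A : ConstGame) : ConstGame :=
  ofLegal (recLegal A) (legalSet_restrict _ _ fun _ : InfBits => A)
    fun Ω => ∃ x : InfBits, A.Wn (Ω.restrict (threadPrefixes x)) = .top

end ConstGame

/-! ### Static games -/

/-- The subsequence of the `p`-labeled moves of a run. -/
noncomputable def Run.movesOf (Γ : Run) (p : Player) : Stream'.Seq Move :=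
  filterMap (fun x : LabMove => if x.1 = p then some x.2 else none) Γ

/-- The `n`-th `p`-labeled move of the run (counting from 0) stands at place `i`. -/
def Run.NthAt (Γ : Run) (p : Player) (n i : ℕ) : Prop :=
  (∃ α, Γ.get? i = some (p, α)) ∧ (Γ.take i).countP (fun x => decide (x.1 = p)) = n

/-- The `n`-th `p`-labeled move is made later than the `k`-th move of the adversary of `p`. -/
def Run.Later (Γ : Run) (p : Player) (n k : ℕ) : Prop :=
  ∃ i j, Γ.NthAt p n i ∧ Γ.NthAt p.adv k j ∧ j < i

/-- `Υ` is a `p`-delay of `Γ`. -/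
def IsDelay (p : Player) (Υ Γ : Run) : Prop :=
  (∀ q, Υ.movesOf q = Γ.movesOf q) ∧ ∀ n k, Γ.Later p n k → Υ.Later p n k

/-- Static constant games. -/
def ConstGame.Static (A : ConstGame) : Prop :=
  ∀ p Υ Γ, IsDelay p Υ Γ →
    (¬ A.Illegal p Γ → ¬ A.Illegal p Υ) ∧ (A.Wn Γ = p → A.Wn Υ = p)

/-! ### Formulas and constant interpretations -/

/-- Formulas, in negation normal form. -/
inductive Formula (Atom : Type u) : Type u where
  | atom (P : Atom)
  | natom (P : Atom)
  | and (F G : Formula Atom)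
  | or (F G : Formula Atom)
  | brec (F : Formula Atom)
  | cobrec (F : Formula Atom)

/-- Constant interpretations: every atom is sent to a static constant game. -/
structure ConstInterp (Atom : Type u) where
  game : Atom → ConstGame
  static : ∀ P, (game P).Static

/-- The constant game `F*`. -/
noncomputable def Formula.interp {Atom : Type u} (I : ConstInterp Atom) :
    Formula Atom → ConstGame
  | .atom P => I.game P
  | .natom P => (I.game P).neg
  | .and F G => (F.interp I).and (G.interp I)
  | .or F G => (F.interp I).or (G.interp I)
  | .brec F => (F.interp I).brec
  | .cobrec F => (F.interp I).cobrec

/-! ### Cirquents -/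

/-- Cirquents with `k` oformulas, `m` undergroups and `n` overgroups. -/
structure Cirquent (Atom : Type u) where
  k : ℕ
  m : ℕ
  n : ℕ
  k_pos : 0 < k
  m_pos : 0 < m
  n_pos : 0 < n
  oformula : Fin k → Formula Atom
  undergroup : Fin m → Finset (Fin k)
  overgroup : Fin n → Finset (Fin k)
  undergroup_nonempty : ∀ i, (undergroup i).Nonempty
  overgroup_nonempty : ∀ j, (overgroup j).Nonempty
  mem_undergroup : ∀ a, ∃ i, a ∈ undergroup i
  mem_overgroup : ∀ a, ∃ j, a ∈ overgroup j

/-- The string `a;u₁,…,uₙ.`. -/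
def cirquentPrefix {n : ℕ} (a : ℕ) (w : Fin n → List Bool) : Move :=
  numeral a ++ [semicolonKey] ++
    List.intercalate [commaKey] (List.ofFn fun j => bitKeys (w j)) ++ [dotKey]

/-- The strings `a;u₁,…,uₙ.` with `uⱼ` a finite initial segment of `xⱼ` for every `j`. -/
def cirquentThread {n : ℕ} (a : ℕ) (x : Fin n → InfBits) : Set Move :=
  {p | ∃ w : Fin n → List Bool, (∀ j, IsInitial (w j) (x j)) ∧ p = cirquentPrefix a w}

/-- The legal runs of the game `C*`. The oformula with index `a : Fin k` is the one with number
`a + 1`. -/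
def Cirquent.legalRuns {Atom : Type u} (C : Cirquent Atom) (I : ConstInterp Atom) : Set Run :=
  {Γ | AllMoves (fun m => ∃ (a : Fin C.k) (w : Fin C.n → List Bool) (α : Move),
        (∀ j, a ∉ C.overgroup j → w j = []) ∧ m = cirquentPrefix (a + 1) w ++ α) Γ ∧
    ∀ ax : Fin C.k × (Fin C.n → InfBits),
      Γ.restrict (cirquentThread (ax.1 + 1) ax.2) ∈ ((C.oformula ax.1).interp I).Lr}

/-- The constant game `C*`. -/
noncomputable def Cirquent.interp {Atom : Type u} (C : Cirquent Atom) (I : ConstInterp Atom) :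
    ConstGame :=
  ConstGame.ofLegal (C.legalRuns I)
    (legalSet_restrict _ (fun ax : Fin C.k × (Fin C.n → InfBits) => cirquentThread (ax.1 + 1) ax.2)
      fun ax => (C.oformula ax.1).interp I)
    fun Ω => ∀ (i : Fin C.m) (x : Fin C.n → InfBits), ∃ a ∈ C.undergroup i,
      ((C.oformula a).interp I).Wn (Ω.restrict (cirquentThread (a + 1) x)) = .top

/-- The cirquent with the single oformula `F`, one undergroup and one overgroup. -/
def Formula.club {Atom : Type u} (F : Formula Atom) : Cirquent Atom where
  k := 1
  m := 1
  n := 1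
  k_pos := one_pos
  m_pos := one_pos
  n_pos := one_pos
  oformula _ := F
  undergroup _ := {0}
  overgroup _ := {0}
  undergroup_nonempty _ := ⟨0, by simp⟩
  overgroup_nonempty _ := ⟨0, by simp⟩
  mem_undergroup a := ⟨0, by simp [Subsingleton.elim a 0]⟩
  mem_overgroup a := ⟨0, by simp [Subsingleton.elim a 0]⟩

/-! ### Games and valuations -/

/-- Valuations; the variables are numbered in their lexicographic order. -/
abbrev Valuation : Type := ℕ → ℕ

/-- Games: functions from valuations to constant games. -/
abbrev Game : Type := Valuation → ConstGame

/-- A constant game seen as a game. -/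
def ConstGame.toGame (A : ConstGame) : Game := fun _ => A

/-! ### Machines

Interactive Turing machines: a finite control, finitely many read/write work tapes, and two
read-only tapes, the run tape and the valuation tape. All tapes are infinite to the right, and a
head that is to go left from the first cell stays there. -/

/-- Hard-play machines, easy-play machines and block-move easy-play machines. -/
inductive Kind where
  | hpm
  | epm
  | bmepm
  deriving DecidableEq

/-- Head movements. -/
inductive Dir where
  | left
  | stay
  | right
  deriving DecidableEq

/-- The new place of a head. -/
def Dir.shift : Dir → ℕ → ℕ
  | .left, h => h - 1
  | .stay, h => h
  | .right, h => h + 1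

/-- Symbols of the run tape. -/
inductive RunSym where
  | blank
  | label (p : Player)
  | key (c : Key)
  deriving DecidableEq

/-- What a machine does on a clock cycle besides changing its state and working on its tapes.
`type c` appends the key `c` to the move that the machine is preparing. `close` (for block-move
machines only) appends the prepared move to the block that the machine is preparing and starts a
new empty move. `make` makes the prepared move (for block-move machines: all the moves of the
prepared block, at once). `permit` grants permission (not for hard-play machines). -/
inductive Action where
  | idle
  | type (c : Key)
  | close
  | make
  | permit
  deriving DecidableEq

/-- What a rule says about one work tape: the scanned symbol that it asks for (`none`: any), the
symbol to be written (`none`: no change), and the movement of the head. -/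
structure WorkOp where
  read : Option ℕ
  write : Option ℕ
  dir : Dir

/-- One rule of a transition table. The `i`-th entry of `work` concerns the `i`-th work tape; the
other work tapes are neither consulted nor changed. `runRead` and `valRead` are the symbols asked
for on the run and the valuation tape (`none`: any). -/
structure Rule where
  state : ℕ
  work : List WorkOp
  runRead : Option RunSym
  runDir : Dir
  valRead : Option Key
  valDir : Dir
  action : Action
  next : ℕ

/-- A machine: its kind and its finite transition table, in which the first applicable rule counts
(so that machines are deterministic). The start state is `0`; the work symbols are natural numbers,
with `0` for the blank. Of the states, work symbols and work tapes, only finitely many occur in the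
table. -/
structure Machine where
  kind : Kind
  table : List Rule

/-- Configurations (without the content of the valuation tape, which never changes). `work i j` is
the symbol in cell `j` of work tape `i`; `run` is the position spelled on the run tape; `typed` is
the move and `block` the block of moves under preparation. -/
structure Config where
  state : ℕ
  work : ℕ → ℕ → ℕ
  workHead : ℕ → ℕ
  run : Position
  runHead : ℕ
  valHead : ℕ
  typed : Move
  block : List Move

/-- The initial configuration. -/
def Config.init : Config where
  state := 0
  work _ _ := 0
  workHead _ := 0
  run := []
  runHead := 0
  valHead := 0
  typed := []
  block := []

/-- The content of the run tape at a given position: the labmoves one after another, each as its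
label followed by its keys, and then blanks. -/
def runTape (Φ : Position) (i : ℕ) : RunSym :=
  (Φ.flatMap fun x => RunSym.label x.1 :: x.2.map RunSym.key).getD i .blank

/-- The content of the valuation tape: the numerals of `e 0`, `e 1`, …, each followed by a
comma. (The cell `i` belongs to one of the first `i + 1` numerals.) -/
def valTape (e : Valuation) (i : ℕ) : Key :=
  ((List.range (i + 1)).flatMap fun v => numeral (e v) ++ [commaKey]).getD i commaKey

/-- The instruction of a rule for work tape `i`. -/
def Rule.op (r : Rule) (i : ℕ) : WorkOp := r.work.getD i ⟨none, none, .stay⟩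

/-- The rule is applicable in a configuration. -/
def Rule.Applies (r : Rule) (e : Valuation) (C : Config) : Prop :=
  r.state = C.state ∧
  (∀ i < r.work.length, ∀ s ∈ (r.op i).read, C.work i (C.workHead i) = s) ∧
  (∀ s ∈ r.runRead, runTape C.run C.runHead = s) ∧
  (∀ s ∈ r.valRead, valTape e C.valHead = s)

instance (r : Rule) (e : Valuation) (C : Config) : Decidable (r.Applies e C) := by
  unfold Rule.Applies; infer_instance

namespace Machine

/-- The rule that the machine follows in a configuration. If no rule is applicable, the machine
has halted. -/
def rule? (M : Machine) (e : Valuation) (C : Config) : Option Rule :=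
  M.table.find? fun r => decide (r.Applies e C)

/-- The action of the machine in a configuration (`idle` if it has halted). -/
def act (M : Machine) (e : Valuation) (C : Config) : Action :=
  ((M.rule? e C).map Rule.action).getD .idle

/-- The machine grants permission in a configuration. -/
def Grants (M : Machine) (e : Valuation) (C : Config) : Prop := M.act e C = .permit

/-- The moves that the machine makes in a configuration: at most one for hard-play and easy-play
machines. -/
def made (M : Machine) (e : Valuation) (C : Config) : List Move :=
  if M.act e C = .make then (if M.kind = .bmepm then C.block else [C.typed]) else []

/-- The moves that the environment may make on the clock cycle that starts in `C`. -/
def EnvAllowed (M : Machine) (e : Valuation) (C : Config) (env : List Move) : Prop :=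
  match M.kind with
  | .hpm => True
  | .epm => env.length ≤ 1 ∧ (env ≠ [] → M.Grants e C)
  | .bmepm => env ≠ [] → M.Grants e C

/-- The update of the state, of the work tapes and of the heads by a rule. -/
def applyRule (r : Rule) (C : Config) : Config :=
  { C with
    state := r.next
    work := fun i => match (r.op i).write with
      | none => C.work i
      | some s => Function.update (C.work i) (C.workHead i) s
    workHead := fun i => (r.op i).dir.shift (C.workHead i)
    runHead := r.runDir.shift C.runHead
    valHead := r.valDir.shift C.valHead }

/-- The update of the move and of the block under preparation. -/
def applyAction (κ : Kind) (a : Action) (C : Config) : Config :=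
  match a with
  | .idle => C
  | .permit => C
  | .type c => { C with typed := C.typed ++ [c] }
  | .close => if κ = .bmepm then { C with typed := [], block := C.block ++ [C.typed] } else C
  | .make => { C with typed := [], block := [] }

/-- The next configuration if the environment makes the moves `env`; these precede the moves that
the machine makes on the same clock cycle. -/
def next (M : Machine) (e : Valuation) (C : Config) (env : List Move) : Config :=
  let C₁ := match M.rule? e C with
    | none => C
    | some r => applyRule r C
  let C₂ := applyAction M.kind (M.act e C) C₁
  { C₂ with
    run := C.run ++ env.map (fun α => (Player.bot, α)) ++
      (M.made e C).map (fun α => (Player.top, α)) }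

/-- `C'` is a successor of `C`. -/
def Succ (M : Machine) (e : Valuation) (C C' : Config) : Prop :=
  ∃ env, M.EnvAllowed e C env ∧ C' = M.next e C env

/-- `B` is an `e`-computation branch of the machine. -/
def IsBranch (M : Machine) (e : Valuation) (B : ℕ → Config) : Prop :=
  B 0 = Config.init ∧ ∀ t, M.Succ e (B t) (B (t + 1))

/-- Permission is granted infinitely many times in the branch. -/
def Fair (M : Machine) (e : Valuation) (B : ℕ → Config) : Prop :=
  ∀ N, ∃ t ≥ N, M.Grants e (B t)

end Machine

/-- The run spelled by a branch. -/
noncomputable def runSpelled (B : ℕ → Config) : Run := listLimit fun t => (B t).run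

/-- The machine wins (solves, computes) the game. -/
def Machine.Wins (M : Machine) (A : Game) : Prop :=
  ∀ e B, M.IsBranch e B →
    (A e).Wn (runSpelled B) = .top ∧
    (M.kind ≠ .hpm → M.Fair e B ∨ (A e).Illegal .bot (runSpelled B))

/-! ### The coding of machines that underlies effectiveness -/

def Player.equiv : Player ≃ Bool where
  toFun
    | .top => true
    | .bot => false
  invFun b := if b then .top else .bot
  left_inv p := by cases p <;> rfl
  right_inv b := by cases b <;> rfl

instance : Primcodable Player := Primcodable.ofEquiv Bool Player.equiv

def Kind.equiv : Kind ≃ Option Bool where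
  toFun
    | .hpm => none
    | .epm => some false
    | .bmepm => some true
  invFun
    | none => .hpm
    | some false => .epm
    | some true => .bmepm
  left_inv p := by cases p <;> rfl
  right_inv b := by rcases b with _ | _ | _ <;> rfl

instance : Primcodable Kind := Primcodable.ofEquiv (Option Bool) Kind.equiv

def Dir.equiv : Dir ≃ Option Bool where
  toFun
    | .stay => none
    | .left => some false
    | .right => some true
  invFun
    | none => .stay
    | some false => .left
    | some true => .right
  left_inv p := by cases p <;> rfl
  right_inv b := by rcases b with _ | _ | _ <;> rfl

instance : Primcodable Dir := Primcodable.ofEquiv (Option Bool) Dir.equiv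

def RunSym.equiv : RunSym ≃ Option (Player ⊕ Key) where
  toFun
    | .blank => none
    | .label p => some (.inl p)
    | .key c => some (.inr c)
  invFun
    | none => .blank
    | some (.inl p) => .label p
    | some (.inr c) => .key c
  left_inv p := by cases p <;> rfl
  right_inv b := by rcases b with _ | _ | _ <;> rfl

instance : Primcodable RunSym := Primcodable.ofEquiv (Option (Player ⊕ Key)) RunSym.equiv

def Action.equiv : Action ≃ Key ⊕ (Bool × Bool) where
  toFun
    | .type c => .inl c
    | .idle => .inr (false, false)
    | .close => .inr (false, true)
    | .make => .inr (true, false)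
    | .permit => .inr (true, true)
  invFun
    | .inl c => .type c
    | .inr (false, false) => .idle
    | .inr (false, true) => .close
    | .inr (true, false) => .make
    | .inr (true, true) => .permit
  left_inv p := by cases p <;> rfl
  right_inv b := by rcases b with _ | ⟨_ | _, _ | _⟩ <;> rfl

instance : Primcodable Action := Primcodable.ofEquiv (Key ⊕ (Bool × Bool)) Action.equiv

def WorkOp.equiv : WorkOp ≃ Option ℕ × Option ℕ × Dir where
  toFun o := (o.read, o.write, o.dir)
  invFun o := ⟨o.1, o.2.1, o.2.2⟩
  left_inv _ := rfl
  right_inv _ := rfl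

instance : Primcodable WorkOp := Primcodable.ofEquiv (Option ℕ × Option ℕ × Dir) WorkOp.equiv

def Rule.equiv : Rule ≃
    ℕ × List WorkOp × Option RunSym × Dir × Option Key × Dir × Action × ℕ where
  toFun r := (r.state, r.work, r.runRead, r.runDir, r.valRead, r.valDir, r.action, r.next)
  invFun r := ⟨r.1, r.2.1, r.2.2.1, r.2.2.2.1, r.2.2.2.2.1, r.2.2.2.2.2.1, r.2.2.2.2.2.2.1,
    r.2.2.2.2.2.2.2⟩
  left_inv _ := rfl
  right_inv _ := rfl

instance : Primcodable Rule :=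
  Primcodable.ofEquiv (ℕ × List WorkOp × Option RunSym × Dir × Option Key × Dir × Action × ℕ)
    Rule.equiv

def Machine.equiv : Machine ≃ Kind × List Rule where
  toFun M := (M.kind, M.table)
  invFun M := ⟨M.1, M.2⟩
  left_inv _ := rfl
  right_inv _ := rfl

instance : Primcodable Machine := Primcodable.ofEquiv (Kind × List Rule) Machine.equiv

end CoL

namespace CoL

/-! ### The simulating machine -/

/-! The simulator plays `F` by running `M` on an imaginary run of `F♣`. A move `α` of the
environment is shown to `M` as `1;0…0.α`, with as many zeros as there have been cycles of `M`, the
current one included. A move `1;0…0.β` of `M`, with any number of zeros, is made as `β`. All other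
moves of `M` are entered in the simulated run and have no effect outside. The real run is therefore
the image of the simulated one under `filterMap visible`, which by `thread_zero` is its restriction
to the thread `000…`.

If the simulated run is legal, `M` has won it in every thread, in particular in `000…`. If it is
illegal, the offender is the environment, since `M` wins; the real run must then be shown to be
illegal by the environment too (`club_illegal`). The danger is a move that is illegal only in some
thread other than `000…`, where earlier moves of `M` differ. The growing number of zeros excludes
this. `M` types at most one key per cycle, so no earlier move contains a bitstring longer than the
number `k` of zeros (`WellTimed`). A move `1;0…0.α` with `k` zeros enters only threads that begin
with `k` zeros, and in these all earlier moves look as they do in `000…`. So an offence in one of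
these threads is an offence in `000…`.

It remains to see that a finite table can do this. A rule of `M` becomes a `fetchRule`, which acts
on work tapes shifted by five and reads work tape `0`, holding the simulated run, in place of the
run tape. A fixed service routine then updates the simulated run and makes the visible moves, and a
`returnRule` enters the next state of `M`. Permission is granted only by fetch rules: where `M`
grants it, and on every cycle if `M` is a hard-play machine. Hence the service routine is
deterministic and can be followed by itself (`Service.Reaches`). The invariant is `Simulates`, its
preservation `Simulates.cycle`; from it every branch of the simulator yields a branch of `M`
(`Machine.IsBranch.exists_simulated`), which also transfers fairness. `M` is first replaced by
`M.total`, so that a halted machine keeps having cycles and the simulation never stops. The table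
depends on `M` only through a uniform translation of its rules, which is primitive recursive. -/

/-- The number by which a symbol of the run tape is represented on a work tape. -/
def RunSym.code : RunSym → ℕ
  | .blank => 0
  | .key c => c.val + 1
  | .label .top => 96
  | .label .bot => 97

/-- The run tape symbol with a given number. -/
def RunSym.ofCode (s : ℕ) : RunSym :=
  if s = 0 then .blank else if s = 96 then .label .top else if s = 97 then .label .bot
  else .key (Fin.ofNat 95 (s - 1))

/-- What the simulator does in one step of its service routine: the symbols written on the four
service tapes, the head movements (the first two tapes share their movements), the action and the
next state. -/
structure Out where
  writeRun : Option ℕ := none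
  writeMark : Option ℕ := none
  writeMove : Option ℕ := none
  writeCount : Option ℕ := none
  dirRun : Dir := .stay
  dirMove : Dir := .stay
  dirCount : Dir := .stay
  dirReal : Dir := .stay
  action : Action := .idle
  next : ℕ

/-- The transition function of the recognizer of the strings `1;0…0.`, with the accepting state `3`
and the failure state `4`. -/
def recognize (a s : ℕ) : ℕ :=
  if a = 0 then (if s = 18 then 1 else 4)
  else if a = 1 then (if s = 28 then 2 else 4)
  else if a = 2 then (if s = 17 then 2 else if s = 15 then 3 else 4)
  else if a = 3 then 3 else 4

/-- The tape whose symbol is consulted in a service state: a service tape for `0`, …, `3`, the run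
tape for `4`. -/
def src : ℕ → ℕ
  | 0 => 0
  | 1 => 1
  | 2 => 1
  | 3 => 0
  | 4 => 4
  | 5 => 0
  | 6 => 0
  | 7 => 3
  | 8 => 3
  | 9 => 0
  | 10 => 4
  | 20 => 1
  | 21 => 1
  | _ => 2

/-- The service routine: what to do in a service state if the consulted symbol is `s`. -/
def prog : ℕ → ℕ → Out
  -- put the markers of the service tapes
  | 0, _ => { writeMark := some 1, writeMove := some 99, dirMove := .right,
              writeCount := some 2, dirCount := .right, next := 30 }
  -- mark the place of the simulated run head and go to the end of the simulated run
  | 1, s => { writeMark := some (if s = 0 then 2 else 3), next := 2 }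
  | 2, s => if s = 1 ∨ s = 3 then { next := 3 } else { dirRun := .left, next := 2 }
  | 3, s => if s = 0 then { next := 4 } else { dirRun := .right, next := 3 }
  -- look for a new move of the environment
  | 4, s => if s = 0 then { next := 11 }
      else if s = 97 then
        { writeRun := some 97, dirRun := .right, dirReal := .right, next := 5 }
      else { dirReal := .right, next := 4 }
  -- append it with a prefix
  | 5, _ => { writeRun := some 18, dirRun := .right, next := 6 }
  | 6, _ => { writeRun := some 28, dirRun := .right, dirCount := .left, next := 7 }
  | 7, s => if s = 1 then
        { writeRun := some 17, dirRun := .right, dirCount := .left, next := 7 }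
      else { dirCount := .right, next := 8 }
  | 8, s => if s = 1 then { dirCount := .right, next := 8 } else { next := 9 }
  | 9, _ => { writeRun := some 15, dirRun := .right, next := 10 }
  | 10, s => if s = 0 then { next := 11 }
      else { writeRun := some s, dirRun := .right, dirReal := .right, next := 10 }
  -- are there moves to be made?
  | 11, s => if s = 100 then { writeMove := some 98, next := 13 }
      else if s = 101 then { writeMove := some 0, dirMove := .left, next := 12 }
      else { next := 20 }
  | 12, s => if s = 98 ∨ s = 99 then { next := 13 }
      else { writeMove := some 0, dirMove := .left, next := 12 }
  | 13, s => if s = 99 then { dirMove := .right, next := 14 }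
      else { dirMove := .left, next := 13 }
  -- append them and make those whose prefix is recognized
  | 14, s => if s = 0 then { writeMove := some 99, dirMove := .right, next := 20 }
      else { writeRun := some 96, dirRun := .right, next := 15 }
  -- return to the place of the simulated run head
  | 20, s => if s = 1 ∨ s = 3 then { next := 21 } else { dirRun := .left, next := 20 }
  | 21, s => if s = 2 then { writeMark := some 0, next := 30 }
      else if s = 3 then { writeMark := some 1, next := 30 }
      else { dirRun := .right, next := 21 }
  | n, s => if s = 98 then
        { dirMove := .right, action := if n = 18 then .make else .idle, next := 14 }
      else
        { writeRun := some s, dirRun := .right, dirMove := .right,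
          action := if n = 18 then .type (Fin.ofNat 95 (s - 1)) else .idle,
          next := 15 + recognize (n - 15) s }

/-- The rule for a service state and a consulted symbol. -/
def serviceRule (p s : ℕ) : Rule where
  state := p
  work := [⟨if src p = 0 then some s else none, (prog p s).writeRun, (prog p s).dirRun⟩,
    ⟨if src p = 1 then some s else none, (prog p s).writeMark, (prog p s).dirRun⟩,
    ⟨if src p = 2 then some s else none, (prog p s).writeMove, (prog p s).dirMove⟩,
    ⟨if src p = 3 then some s else none, (prog p s).writeCount, (prog p s).dirCount⟩]
  runRead := if src p = 4 then some (RunSym.ofCode s) else none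
  runDir := (prog p s).dirReal
  valRead := none
  valDir := .stay
  action := (prog p s).action
  next := (prog p s).next

/-- State `30` is left to `returnRule` and the states from `32` on to `fetchRule`, so that rules of
different kinds never compete. The codes on the run tape are below `98`. The tape of prepared moves
needs more symbols: `98` ends a closed move, `99` marks the left end, and `100` or `101` records
that `make` is pending. -/
def serviceTable : List Rule :=
  (List.range 30).flatMap fun p => (List.range (if src p = 4 then 98 else 102)).map (serviceRule p)

/-- What the simulation of an action does on the tape of prepared moves. -/
def moveOp (κ : Kind) : Action → WorkOp
  | .type c => ⟨none, some (c.val + 1), .right⟩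
  | .close => if κ = .bmepm then ⟨none, some 98, .right⟩ else ⟨none, none, .stay⟩
  | .make => if κ = .bmepm then ⟨none, some 101, .stay⟩ else ⟨none, some 100, .stay⟩
  | _ => ⟨none, none, .stay⟩

/-- Permission is granted when the simulated machine lets the environment move. -/
def fetchAction (κ : Kind) (a : Action) : Action :=
  if κ = .hpm ∨ a = .permit then .permit else .idle

/-- The simulation of a rule. -/
def fetchRule (κ : Kind) (r : Rule) : Rule where
  state := r.state + 32
  work := [⟨r.runRead.map RunSym.code, none, r.runDir⟩, ⟨none, none, r.runDir⟩,
    moveOp κ r.action, ⟨none, some 1, .right⟩, ⟨none, some r.next, .stay⟩] ++ r.work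
  runRead := none
  runDir := .stay
  valRead := r.valRead
  valDir := r.valDir
  action := fetchAction κ r.action
  next := 1

/-- The return from the service routine to the simulation of state `q`. -/
def returnRule (q : ℕ) : Rule where
  state := 30
  work := [⟨none, none, .stay⟩, ⟨none, none, .stay⟩, ⟨none, none, .stay⟩, ⟨none, none, .stay⟩,
    ⟨some q, none, .stay⟩]
  runRead := none
  runDir := .stay
  valRead := none
  valDir := .stay
  action := .idle
  next := q + 32

/-- The rule that does nothing in state `q`. -/
def idleRule (q : ℕ) : Rule := ⟨q, [], none, .stay, none, .stay, .idle, q⟩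

/-- The machine that goes on idling where `M` halts. -/
def Machine.total (M : Machine) : Machine where
  kind := M.kind
  table := M.table ++ idleRule 0 :: M.table.map fun r => idleRule r.next

/-- The simulator. -/
def Machine.simulator (M : Machine) : Machine where
  kind := .epm
  table := serviceTable ++ (M.table.map (fun r => returnRule r.next) ++
    M.table.map (fetchRule M.kind))

/-! ### Effectiveness -/

instance : Finite Player := Finite.of_equiv _ Player.equiv.symm
instance : Finite RunSym := Finite.of_equiv _ RunSym.equiv.symm
instance : Finite Action := Finite.of_equiv _ Action.equiv.symm
instance : Finite Kind := Finite.of_equiv _ Kind.equiv.symm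

theorem Rule.primrec_mk {α : Type*} [Primcodable α] {f1 : α → ℕ} {f2 : α → List WorkOp}
    {f3 : α → Option RunSym} {f4 : α → Dir} {f5 : α → Option Key} {f6 : α → Dir}
    {f7 : α → Action} {f8 : α → ℕ} (h1 : Primrec f1) (h2 : Primrec f2) (h3 : Primrec f3)
    (h4 : Primrec f4) (h5 : Primrec f5) (h6 : Primrec f6) (h7 : Primrec f7) (h8 : Primrec f8) :
    Primrec fun a => Rule.mk (f1 a) (f2 a) (f3 a) (f4 a) (f5 a) (f6 a) (f7 a) (f8 a) :=
  (Primrec.of_equiv_symm (e := Rule.equiv)).comp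
    (h1.pair (h2.pair (h3.pair (h4.pair (h5.pair (h6.pair (h7.pair h8)))))))

theorem WorkOp.primrec_mk {α : Type*} [Primcodable α] {f1 f2 : α → Option ℕ} {f3 : α → Dir}
    (h1 : Primrec f1) (h2 : Primrec f2) (h3 : Primrec f3) :
    Primrec fun a => WorkOp.mk (f1 a) (f2 a) (f3 a) :=
  (Primrec.of_equiv_symm (e := WorkOp.equiv)).comp (h1.pair (h2.pair h3))

theorem Machine.primrec_mk {α : Type*} [Primcodable α] {f1 : α → Kind} {f2 : α → List Rule}
    (h1 : Primrec f1) (h2 : Primrec f2) : Primrec fun a => Machine.mk (f1 a) (f2 a) :=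
  (Primrec.of_equiv_symm (e := Machine.equiv)).comp (h1.pair h2)

theorem Rule.primrec_equiv : Primrec Rule.equiv := Primrec.of_equiv (e := Rule.equiv)

theorem Rule.primrec_state : Primrec Rule.state := Primrec.fst.comp Rule.primrec_equiv

theorem Rule.primrec_work : Primrec Rule.work :=
  (Primrec.fst.comp Primrec.snd).comp Rule.primrec_equiv

theorem Rule.primrec_runRead : Primrec Rule.runRead :=
  (Primrec.fst.comp (Primrec.snd.comp Primrec.snd)).comp Rule.primrec_equiv

theorem Rule.primrec_runDir : Primrec Rule.runDir :=
  (Primrec.fst.comp (Primrec.snd.comp (Primrec.snd.comp Primrec.snd))).comp Rule.primrec_equiv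

theorem Rule.primrec_valRead : Primrec Rule.valRead :=
  (Primrec.fst.comp (Primrec.snd.comp (Primrec.snd.comp
    (Primrec.snd.comp Primrec.snd)))).comp Rule.primrec_equiv

theorem Rule.primrec_valDir : Primrec Rule.valDir :=
  (Primrec.fst.comp (Primrec.snd.comp (Primrec.snd.comp (Primrec.snd.comp
    (Primrec.snd.comp Primrec.snd))))).comp Rule.primrec_equiv

theorem Rule.primrec_action : Primrec Rule.action :=
  (Primrec.fst.comp (Primrec.snd.comp (Primrec.snd.comp (Primrec.snd.comp (Primrec.snd.comp
    (Primrec.snd.comp Primrec.snd)))))).comp Rule.primrec_equiv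

theorem Rule.primrec_next : Primrec Rule.next :=
  (Primrec.snd.comp (Primrec.snd.comp (Primrec.snd.comp (Primrec.snd.comp (Primrec.snd.comp
    (Primrec.snd.comp Primrec.snd)))))).comp Rule.primrec_equiv

theorem Machine.primrec_equiv : Primrec Machine.equiv := Primrec.of_equiv (e := Machine.equiv)

theorem Machine.primrec_kind : Primrec Machine.kind := Primrec.fst.comp Machine.primrec_equiv

theorem Machine.primrec_table : Primrec Machine.table := Primrec.snd.comp Machine.primrec_equiv

/-- The kind, the action and the run symbol range over finite types, where every function is
primitive recursive; the rest consists of projections, one addition and list operations. -/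
theorem primrec_fetchRule : Primrec₂ fetchRule := by
  have hr : Primrec fun x : Kind × Rule => x.2 := Primrec.snd
  have hop : Primrec fun x : Kind × Rule => moveOp x.1 x.2.action :=
    (Primrec.dom_finite fun x : Kind × Action => moveOp x.1 x.2).comp
      (Primrec.fst.pair (Rule.primrec_action.comp hr))
  have hact : Primrec fun x : Kind × Rule => fetchAction x.1 x.2.action :=
    (Primrec.dom_finite fun x : Kind × Action => fetchAction x.1 x.2).comp
      (Primrec.fst.pair (Rule.primrec_action.comp hr))
  have hdir := Rule.primrec_runDir.comp hr
  have hnone : Primrec fun _ : Kind × Rule => (none : Option ℕ) := Primrec.const _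
  have hcode : Primrec fun x : Kind × Rule => x.2.runRead.map RunSym.code :=
    (Primrec.option_map₁ (Primrec.dom_finite RunSym.code)).comp (Rule.primrec_runRead.comp hr)
  refine Rule.primrec_mk (Primrec.nat_add.comp (Rule.primrec_state.comp hr) (Primrec.const 32))
    (Primrec.list_append.comp ?_ (Rule.primrec_work.comp hr)) (Primrec.const _) (Primrec.const _)
    (Rule.primrec_valRead.comp hr) (Rule.primrec_valDir.comp hr) hact (Primrec.const _)
  refine Primrec.list_cons.comp (WorkOp.primrec_mk hcode hnone hdir) <|
    Primrec.list_cons.comp (WorkOp.primrec_mk hnone hnone hdir) <|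
    Primrec.list_cons.comp hop <|
    Primrec.list_cons.comp (Primrec.const _) <|
    Primrec.list_cons.comp (WorkOp.primrec_mk hnone
      (Primrec.option_some.comp (Rule.primrec_next.comp hr)) (Primrec.const _)) <|
    Primrec.const _

theorem primrec_returnRule : Primrec returnRule := by
  refine Rule.primrec_mk (Primrec.const _) ?_ (Primrec.const _) (Primrec.const _)
    (Primrec.const _) (Primrec.const _) (Primrec.const _)
    (Primrec.nat_add.comp Primrec.id (Primrec.const 32))
  refine Primrec.list_cons.comp (Primrec.const _) <| Primrec.list_cons.comp (Primrec.const _) <|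
    Primrec.list_cons.comp (Primrec.const _) <| Primrec.list_cons.comp (Primrec.const _) <|
    Primrec.list_cons.comp (WorkOp.primrec_mk Primrec.option_some (Primrec.const _)
      (Primrec.const _)) <| Primrec.const _

theorem primrec_idleRule : Primrec idleRule :=
  Rule.primrec_mk Primrec.id (Primrec.const _) (Primrec.const _) (Primrec.const _)
    (Primrec.const _) (Primrec.const _) (Primrec.const _) Primrec.id

theorem Machine.primrec_total : Primrec Machine.total :=
  Machine.primrec_mk Machine.primrec_kind <|
    Primrec.list_append.comp Machine.primrec_table <|
      Primrec.list_cons.comp (Primrec.const _) <|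
        Primrec.list_map Machine.primrec_table
          ((primrec_idleRule.comp Rule.primrec_next).comp Primrec.snd).to₂

theorem Machine.primrec_simulator : Primrec Machine.simulator :=
  Machine.primrec_mk (Primrec.const _) <|
    Primrec.list_append.comp (Primrec.const _) <|
      Primrec.list_append.comp
        (Primrec.list_map Machine.primrec_table
          ((primrec_returnRule.comp Rule.primrec_next).comp Primrec.snd).to₂)
        (Primrec.list_map Machine.primrec_table
          (primrec_fetchRule.comp (Machine.primrec_kind.comp Primrec.fst) Primrec.snd).to₂)

/-! ### The service routine as a deterministic process -/

/-- The part of a configuration of the simulator that the service routine works on. -/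
structure Service where
  state : ℕ
  simRun : ℕ → ℕ
  marks : ℕ → ℕ
  moves : ℕ → ℕ
  count : ℕ → ℕ
  runHead : ℕ
  moveHead : ℕ
  countHead : ℕ
  realHead : ℕ
  typed : Move
  run : Position

namespace Service

/-- The symbol consulted. -/
def sym (c : Service) : ℕ :=
  if src c.state = 0 then c.simRun c.runHead
  else if src c.state = 1 then c.marks c.runHead
  else if src c.state = 2 then c.moves c.moveHead
  else if src c.state = 3 then c.count c.countHead
  else (runTape c.run c.realHead).code

/-- Writing on a tape. -/
def write (f : ℕ → ℕ) (h : ℕ) : Option ℕ → ℕ → ℕ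
  | none => f
  | some s => Function.update f h s

/-- One step of the service routine with a given output of the program. -/
def apply (c : Service) (o : Out) : Service where
  state := o.next
  simRun := write c.simRun c.runHead o.writeRun
  marks := write c.marks c.runHead o.writeMark
  moves := write c.moves c.moveHead o.writeMove
  count := write c.count c.countHead o.writeCount
  runHead := o.dirRun.shift c.runHead
  moveHead := o.dirMove.shift c.moveHead
  countHead := o.dirCount.shift c.countHead
  realHead := o.dirReal.shift c.realHead
  typed := match o.action with
    | .type k => c.typed ++ [k]
    | .make => []
    | _ => c.typed
  run := if o.action = .make then c.run ++ [(.top, c.typed)] else c.run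

/-- One step of the service routine. -/
def step (c : Service) : Service := c.apply (prog c.state c.sym)

/-- The symbol consulted is one that the service table deals with. -/
def Ready (c : Service) : Prop := c.state < 30 ∧ c.sym < if src c.state = 4 then 98 else 102

/-- The configuration of the simulator given by the state of the service routine and the remaining
components. -/
def toConfig (c : Service) (base : Config) : Config where
  state := c.state
  work := fun i => match i with
    | 0 => c.simRun
    | 1 => c.marks
    | 2 => c.moves
    | 3 => c.count
    | i + 4 => base.work (i + 4)
  workHead := fun i => match i with
    | 0 => c.runHead
    | 1 => c.runHead
    | 2 => c.moveHead
    | 3 => c.countHead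
    | i + 4 => base.workHead (i + 4)
  run := c.run
  runHead := c.realHead
  valHead := base.valHead
  typed := c.typed
  block := []

/-- The service routine leads from `c` to `d`. -/
def Reaches : Service → Service → Prop := Relation.ReflTransGen fun c d => c.Ready ∧ d = c.step

end Service

/-! ### Codes of run symbols, and the rule chosen in a service state. -/

theorem RunSym.ofCode_code (σ : RunSym) : RunSym.ofCode σ.code = σ := by
  rcases σ with _ | ⟨_ | _⟩ | c
  · rfl
  · rfl
  · rfl
  · have := c.2
    change RunSym.ofCode (c.val + 1) = _
    unfold RunSym.ofCode
    rw [if_neg (by omega), if_neg (by omega), if_neg (by omega)]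
    congr 1
    apply Fin.ext
    simp [Fin.ofNat, Nat.mod_eq_of_lt this]

theorem RunSym.code_ofCode {s : ℕ} (h : s < 98) : (RunSym.ofCode s).code = s := by
  unfold RunSym.ofCode
  split_ifs with h1 h2 h3
  · simp [RunSym.code, h1]
  · simp [RunSym.code, h2]
  · simp [RunSym.code, h3]
  · simp only [RunSym.code, Fin.val_ofNat]
    rw [Nat.mod_eq_of_lt (by omega)]
    omega

theorem RunSym.code_injective : Function.Injective RunSym.code :=
  Function.LeftInverse.injective RunSym.ofCode_code

theorem RunSym.code_lt (σ : RunSym) : σ.code < 98 := by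
  rcases σ with _ | ⟨_ | _⟩ | c <;> simp only [RunSym.code] <;> omega

/-- If only one rule is applicable, the order of the table does not matter, and membership suffices
for looking a rule up. -/
theorem find?_eq_some_of_unique {α : Type*} {p : α → Bool} {l : List α} {a : α} (ha : a ∈ l)
    (hp : p a = true) (h : ∀ b ∈ l, p b = true → b = a) : l.find? p = some a := by
  rcases hf : l.find? p with _ | b
  · exact absurd hp (by simpa using List.find?_eq_none.1 hf a ha)
  · rw [h b (List.mem_of_find?_eq_some hf) (List.find?_some hf)]

theorem src_le (p : ℕ) : src p ≤ 4 := by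
  unfold src; split <;> omega

/-- A service rule consults only the tape named by `src`. The bound on `s` is needed for the run
tape, since `RunSym.ofCode` and `RunSym.code` are inverse to each other only below `98`. -/
theorem serviceRule_applies {p s : ℕ} (hs : s < if src p = 4 then 98 else 102) {e : Valuation}
    {c : Service} {base : Config} :
    (serviceRule p s).Applies e (c.toConfig base) ↔ c.state = p ∧ c.sym = s := by
  have h4 := src_le p
  unfold Rule.Applies
  have h : ∀ P : ℕ → Prop, (∀ i < (serviceRule p s).work.length, P i) ↔ P 0 ∧ P 1 ∧ P 2 ∧ P 3 := by
    intro P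
    constructor
    · intro h
      exact ⟨h 0 (by simp [serviceRule]), h 1 (by simp [serviceRule]), h 2 (by simp [serviceRule]),
        h 3 (by simp [serviceRule])⟩
    · rintro ⟨h0, h1, h2, h3⟩ i hi
      simp only [serviceRule, List.length_cons, List.length_nil] at hi
      interval_cases i <;> assumption
  rw [h]
  by_cases hp : c.state = p
  · subst hp
    simp only [serviceRule, Rule.op, List.getD_cons_zero, List.getD_cons_succ,
      Service.toConfig, Service.sym]
    interval_cases hsrc : src c.state <;> simp <;> try rw [hsrc]
    rw [if_pos rfl] at hs
    constructor
    · intro h; rw [h, RunSym.code_ofCode hs]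
    · intro h; rw [← h, RunSym.ofCode_code]
  · constructor
    · intro h
      exact absurd h.1.symm hp
    · intro h
      exact absurd h.1 hp

theorem Machine.rule?_simulator {M : Machine} {e : Valuation} {c : Service} {base : Config}
    (hc : c.Ready) : M.simulator.rule? e (c.toConfig base) = some (serviceRule c.state c.sym) := by
  refine find?_eq_some_of_unique ?_ ?_ ?_
  · refine List.mem_append_left _ (List.mem_flatMap.2 ⟨c.state, List.mem_range.2 hc.1, ?_⟩)
    exact List.mem_map.2 ⟨c.sym, List.mem_range.2 hc.2, rfl⟩
  · exact decide_eq_true ((serviceRule_applies hc.2).2 ⟨rfl, rfl⟩)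
  · intro r hr happ
    have happ := of_decide_eq_true happ
    rcases List.mem_append.1 hr with hr | hr
    · obtain ⟨p, -, hr⟩ := List.mem_flatMap.1 hr
      obtain ⟨s, hs, rfl⟩ := List.mem_map.1 hr
      obtain ⟨rfl, rfl⟩ := (serviceRule_applies (List.mem_range.1 hs)).1 happ
      rfl
    · have hst : r.state = c.state := happ.1
      have h30 := hc.1
      rcases List.mem_append.1 hr with hr | hr
      · obtain ⟨q, -, rfl⟩ := List.mem_map.1 hr
        simp only [returnRule] at hst
        omega
      · obtain ⟨q, -, rfl⟩ := List.mem_map.1 hr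
        simp only [fetchRule] at hst
        omega

/-- This makes the service routine deterministic: without permission the environment cannot
interfere. -/
theorem prog_action_ne (p s : ℕ) : (prog p s).action ≠ .permit := by
  unfold prog
  split <;> (try split_ifs) <;> simp

theorem prog_action_close (p s : ℕ) : (prog p s).action ≠ .close := by
  unfold prog
  split <;> (try split_ifs) <;> simp

theorem Machine.not_grants_service {M : Machine} {e : Valuation} {c : Service} {base : Config}
    (hc : c.Ready) : ¬ M.simulator.Grants e (c.toConfig base) := by
  unfold Machine.Grants Machine.act
  rw [Machine.rule?_simulator hc]
  exact prog_action_ne _ _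

/-- What lies outside `Service` is carried along unchanged in `base`: service rules say nothing
about the work tapes from `4` on and leave the valuation head in place. -/
theorem Machine.next_service {M : Machine} {e : Valuation} {c : Service} {base : Config}
    (hc : c.Ready) :
    M.simulator.next e (c.toConfig base) [] = c.step.toConfig base := by
  have hact : M.simulator.act e (c.toConfig base) = (prog c.state c.sym).action := by
    unfold Machine.act
    rw [Machine.rule?_simulator hc]
    rfl
  have hcl := prog_action_close c.state c.sym
  have hpe := prog_action_ne c.state c.sym
  unfold Machine.next Machine.made
  rw [Machine.rule?_simulator hc, hact]
  have hk : M.simulator.kind = .epm := rfl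
  rw [hk]
  unfold Service.step
  have hw : ∀ i, (applyRule (serviceRule c.state c.sym) (c.toConfig base)).work i
      = ((c.apply (prog c.state c.sym)).toConfig base).work i := by
    rintro (_ | _ | _ | _ | i) <;>
      simp only [applyRule, Rule.op, serviceRule, List.getD_cons_zero, List.getD_cons_succ,
        Service.toConfig, Service.apply, List.getD_nil]
    · cases (prog c.state c.sym).writeRun <;> rfl
    · cases (prog c.state c.sym).writeMark <;> rfl
    · cases (prog c.state c.sym).writeMove <;> rfl
    · cases (prog c.state c.sym).writeCount <;> rfl
  have hh : ∀ i, (applyRule (serviceRule c.state c.sym) (c.toConfig base)).workHead i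
      = ((c.apply (prog c.state c.sym)).toConfig base).workHead i := by
    rintro (_ | _ | _ | _ | i) <;>
      simp only [applyRule, Rule.op, serviceRule, List.getD_cons_zero, List.getD_cons_succ,
        Service.toConfig, Service.apply, List.getD_nil] <;> rfl
  have hw := funext hw
  have hh := funext hh
  rcases ha : (prog c.state c.sym).action with _ | k | _ | _ | _
  · refine Config.mk.injEq .. ▸ ⟨rfl, hw, hh, ?_, rfl, rfl, ?_, rfl⟩ <;>
      simp [Service.apply, Service.toConfig, applyAction, ha, applyRule]
  · refine Config.mk.injEq .. ▸ ⟨rfl, hw, hh, ?_, rfl, rfl, ?_, rfl⟩ <;>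
      simp [Service.apply, Service.toConfig, applyAction, ha, applyRule]
  · exact absurd ha hcl
  · refine Config.mk.injEq .. ▸ ⟨rfl, hw, hh, ?_, rfl, rfl, ?_, rfl⟩ <;>
      simp [Service.apply, Service.toConfig, applyAction, ha]
  · exact absurd ha hpe

/-! ### Tapes -/

/-- From the cell `p` on, the tape spells `l`, followed by blanks. -/
def Spells (f : ℕ → ℕ) (p : ℕ) (l : List ℕ) : Prop := ∀ j, f (p + j) = l.getD j 0

/-- The tape that spells `l`. -/
def tape (l : List ℕ) : ℕ → ℕ := fun j => l.getD j 0

theorem update_tape (l : List ℕ) (s : ℕ) :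
    Function.update (tape l) l.length s = tape (l ++ [s]) := by
  funext j
  unfold tape
  rcases lt_trichotomy j l.length with h | h | h
  · rw [Function.update_of_ne h.ne]
    exact (List.getD_append _ _ _ _ h).symm
  · subst h; simp
  · rw [Function.update_of_ne h.ne', List.getD_eq_default _ _ h.le,
      List.getD_eq_default _ _ (by simp; omega)]

theorem Spells.append {f : ℕ → ℕ} {p : ℕ} {l : List ℕ} (h : Spells f p l) (s : ℕ) :
    Spells (Function.update f (p + l.length) s) p (l ++ [s]) := by
  intro j
  have h1 := congrFun (update_tape l s) j
  simp only [tape] at h1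
  rw [← h1]
  by_cases hj : j = l.length
  · subst hj; simp
  · rw [Function.update_of_ne (by omega), Function.update_of_ne hj]
    exact h j

theorem Spells.pop {f : ℕ → ℕ} {p : ℕ} {l : List ℕ} {s : ℕ} (h : Spells f p (l ++ [s])) :
    Spells (Function.update f (p + l.length) 0) p l := by
  intro j
  rcases lt_trichotomy j l.length with hj | hj | hj
  · rw [Function.update_of_ne (by omega), h j, List.getD_append _ _ _ _ hj]
  · subst hj; simp
  · rw [Function.update_of_ne (by omega), h j, List.getD_eq_default _ _ hj.le,
      List.getD_eq_default _ _ (by simp; omega)]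

theorem Spells.drop {f : ℕ → ℕ} {p : ℕ} {l l' : List ℕ} (h : Spells f p (l ++ l')) :
    Spells f (p + l.length) l' := by
  intro j
  rw [Nat.add_assoc, h, List.getD_append_right _ _ _ _ (by omega)]
  congr 1
  omega

theorem Spells.head {f : ℕ → ℕ} {p a : ℕ} {l : List ℕ} (h : Spells f p (a :: l)) : f p = a :=
  h 0

theorem Spells.tail {f : ℕ → ℕ} {p a : ℕ} {l : List ℕ} (h : Spells f p (a :: l)) :
    Spells f (p + 1) l := Spells.drop (l := [a]) h

theorem Spells.head_nil {f : ℕ → ℕ} {p : ℕ} (h : Spells f p []) : f p = 0 := h 0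

/-- The text of a position on the run tape. -/
def text (Φ : Position) : List RunSym :=
  Φ.flatMap fun x => RunSym.label x.1 :: x.2.map RunSym.key

theorem runTape_eq (Φ : Position) (i : ℕ) : runTape Φ i = (text Φ).getD i .blank := rfl

theorem text_append (Φ Ψ : Position) : text (Φ ++ Ψ) = text Φ ++ text Ψ := List.flatMap_append

theorem text_ne_blank {Φ : Position} {σ : RunSym} (h : σ ∈ text Φ) : σ.code ≠ 0 := by
  obtain ⟨x, -, h⟩ := List.mem_flatMap.1 h
  rcases List.mem_cons.1 h with rfl | h
  · cases x.1 <;> simp [RunSym.code]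
  · obtain ⟨k, -, rfl⟩ := List.mem_map.1 h
    simp [RunSym.code]

/-- A move as a list of symbols of a work tape. -/
def moveCode (m : Move) : List ℕ := m.map fun k => k.val + 1

/-- The simulated run as a list of symbols of a work tape. -/
def textCode (Φ : Position) : List ℕ := (text Φ).map RunSym.code

theorem textCode_append (Φ Ψ : Position) : textCode (Φ ++ Ψ) = textCode Φ ++ textCode Ψ := by
  simp [textCode, text_append]

theorem textCode_singleton (p : Player) (m : Move) :
    textCode [(p, m)] = (RunSym.label p).code :: moveCode m := by
  simp [textCode, text, moveCode, RunSym.code]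

theorem tape_textCode (Φ : Position) (j : ℕ) : tape (textCode Φ) j = (runTape Φ j).code := by
  unfold tape textCode
  rw [runTape_eq]
  exact List.getD_map (text Φ) RunSym.blank RunSym.code

namespace Service

theorem Reaches.step {c d : Service} (hc : c.Ready) (h : Reaches c.step d) : Reaches c d :=
  Relation.ReflTransGen.head ⟨hc, rfl⟩ h

theorem Reaches.trans {c d d' : Service} (h : Reaches c d) (h' : Reaches d d') : Reaches c d' :=
  Relation.ReflTransGen.trans h h'

theorem Reaches.refl (c : Service) : Reaches c c := Relation.ReflTransGen.refl

/-! ### The movements of the simulated run head -/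

/-- Only cell `0` stops the head. It carries `1`, or `3` if it is at the same time the marked place
of the simulated run head; a marked place elsewhere carries `2`. -/
theorem reaches_left {p : ℕ} (hp : p = 2 ∨ p = 20) {f : ℕ → ℕ} (h0 : f 0 = 1 ∨ f 0 = 3)
    (h1 : ∀ j ≠ 0, f j = 0 ∨ f j = 2) (c : Service) (h : ℕ) :
    Reaches { c with state := p, marks := f, runHead := h }
      { c with state := p + 1, marks := f, runHead := 0 } := by
  induction h with
  | zero =>
    have hs : sym { c with state := p, marks := f, runHead := 0 } = f 0 := by
      rcases hp with rfl | rfl <;> simp [sym, src]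
    refine Reaches.step ⟨?_, ?_⟩ ?_
    · rcases hp with rfl | rfl <;> simp
    · rw [hs]
      split_ifs <;> omega
    · rw [Service.step, hs]
      rcases hp with rfl | rfl <;> simp only [prog, h0, if_true] <;> exact Reaches.refl _
  | succ h ih =>
    have hs : sym { c with state := p, marks := f, runHead := h + 1 } = f (h + 1) := by
      rcases hp with rfl | rfl <;> simp [sym, src]
    have hf := h1 (h + 1) (by omega)
    have hn : ¬ (f (h + 1) = 1 ∨ f (h + 1) = 3) := by omega
    refine Reaches.step ⟨?_, ?_⟩ ?_
    · rcases hp with rfl | rfl <;> simp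
    · rw [hs]
      split_ifs <;> omega
    · rw [Service.step, hs]
      rcases hp with rfl | rfl <;> simp only [prog, hn, if_false] <;> exact ih

/-- No code in `l` is `0`, so the first blank met is the one after the last symbol. The variable `k`
counts the cells still to be crossed. -/
theorem reaches_end {l : List ℕ} (hl : ∀ s ∈ l, s ≠ 0 ∧ s < 102) (c : Service) (k i : ℕ)
    (h : i + k = l.length) :
    Reaches { c with state := 3, simRun := tape l, runHead := i }
      { c with state := 4, simRun := tape l, runHead := l.length } := by
  induction k generalizing i with
  | zero =>
    obtain rfl : i = l.length := by omega
    have hs : sym { c with state := 3, simRun := tape l, runHead := l.length } = 0 := by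
      simp [sym, src, tape]
    refine Reaches.step ⟨by simp, ?_⟩ ?_
    · rw [hs]; split_ifs <;> omega
    · rw [Service.step, hs]
      exact Reaches.refl _
  | succ k ih =>
    have hi : i < l.length := by omega
    have hs : sym { c with state := 3, simRun := tape l, runHead := i } = l[i] := by
      simp [sym, src, tape, hi]
    have hm := hl _ (List.getElem_mem hi)
    refine Reaches.step ⟨by simp, ?_⟩ ?_
    · rw [hs]; simpa [src] using hm.2
    · rw [Service.step, hs]
      simp only [prog, hm.1, if_false]
      exact ih (i + 1) (by omega)

/-- The content of the second service tape while the simulated run head is in place. -/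
def startMark : ℕ → ℕ := fun j => if j = 0 then 1 else 0

/-- The content of the second service tape while the place `h` is marked. -/
def placeMark (h : ℕ) : ℕ → ℕ := Function.update startMark h (if h = 0 then 3 else 2)

theorem placeMark_zero (h : ℕ) : placeMark h 0 = 1 ∨ placeMark h 0 = 3 := by
  unfold placeMark
  by_cases hh : h = 0
  · subst hh; simp
  · rw [Function.update_of_ne (Ne.symm hh)]; simp [startMark]

theorem placeMark_ne (h : ℕ) : ∀ j ≠ 0, placeMark h j = 0 ∨ placeMark h j = 2 := by
  intro j hj
  unfold placeMark
  by_cases hh : j = h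
  · subst hh; simp [hj]
  · rw [Function.update_of_ne hh]; simp [startMark, hj]

/-- The heads of the first two service tapes always stand at the same place. A mark on the second
tape can therefore remember a place on the first while the first is being extended. -/
theorem reaches_goToEnd {l : List ℕ} (hl : ∀ s ∈ l, s ≠ 0 ∧ s < 102) (c : Service) (h : ℕ) :
    Reaches { c with state := 1, simRun := tape l, marks := startMark, runHead := h }
      { c with state := 4, simRun := tape l, marks := placeMark h, runHead := l.length } := by
  have hs : sym { c with state := 1, simRun := tape l, marks := startMark, runHead := h }
      = startMark h := by simp [sym, src]
  refine Reaches.step ⟨by simp, ?_⟩ ?_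
  · rw [hs]; unfold startMark; split_ifs <;> simp
  · rw [Service.step, hs]
    have e : apply { c with state := 1, simRun := tape l, marks := startMark, runHead := h }
        (prog 1 (startMark h)) =
        { c with state := 2, simRun := tape l, marks := placeMark h, runHead := h } := by
      by_cases hh : h = 0
      · subst hh; simp [apply, prog, write, Dir.shift, placeMark, startMark]
      · simp [apply, prog, write, Dir.shift, placeMark, startMark, hh]
    simp only at e ⊢
    rw [e]
    refine (reaches_left (.inl rfl) (placeMark_zero h) (placeMark_ne h)
      { c with simRun := tape l } h).trans ?_
    exact reaches_end hl { c with marks := placeMark h } l.length 0 (by omega)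

/-- Going back to cell `0` before searching makes sure that the mark lies ahead, wherever the head
was left. -/
theorem reaches_return (c : Service) (h : ℕ) (h' : ℕ) :
    Reaches { c with state := 20, marks := placeMark h, runHead := h' }
      { c with state := 30, marks := startMark, runHead := h } := by
  refine (reaches_left (.inr rfl) (placeMark_zero h) (placeMark_ne h) c h').trans ?_
  have key : ∀ k i, i + k = h →
      Reaches { c with state := 21, marks := placeMark h, runHead := i }
        { c with state := 30, marks := startMark, runHead := h } := by
    intro k
    induction k with
    | zero =>
      rintro i hi
      obtain rfl : i = h := by omega
      have hs : sym { c with state := 21, marks := placeMark i, runHead := i }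
          = if i = 0 then 3 else 2 := by simp [sym, src, placeMark]
      refine Reaches.step ⟨by simp, ?_⟩ ?_
      · rw [hs]; simp only [src]; split_ifs <;> omega
      · rw [Service.step, hs]
        have e : apply { c with state := 21, marks := placeMark i, runHead := i }
            (prog 21 (if i = 0 then 3 else 2)) =
            { c with state := 30, marks := startMark, runHead := i } := by
          by_cases hh : i = 0
          · subst hh
            simp only [apply, prog, write, Dir.shift, placeMark, if_true, Function.update_idem]
            simp [startMark]
          · simp only [apply, prog, write, Dir.shift, placeMark, if_neg hh, Function.update_idem]
            simp [startMark, hh]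
        simp only at e ⊢
        rw [e]
        exact Reaches.refl _
    | succ k ih =>
      intro i hi
      have hs : sym { c with state := 21, marks := placeMark h, runHead := i } = startMark i := by
        simp only [sym, src, placeMark]
        rw [Function.update_of_ne (by omega)]
        simp
      refine Reaches.step ⟨by simp, ?_⟩ ?_
      · rw [hs]; simp only [src, startMark]; split_ifs <;> omega
      · rw [Service.step, hs]
        have e : apply { c with state := 21, marks := placeMark h, runHead := i }
            (prog 21 (startMark i)) =
            { c with state := 21, marks := placeMark h, runHead := i + 1 } := by
          have h2 : startMark i ≠ 2 := by unfold startMark; split_ifs <;> omega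
          have h3 : startMark i ≠ 3 := by unfold startMark; split_ifs <;> omega
          simp [apply, prog, write, Dir.shift, h2, h3]
        simp only at e ⊢
        rw [e]
        exact ih (i + 1) (by omega)
  exact key h 0 (by omega)

/-! ### Appending a move of the environment to the simulated run -/

theorem runTape_of_text {Φ : Position} {pre post : List RunSym} (h : text Φ = pre ++ post) :
    runTape Φ pre.length = post.head?.getD .blank := by
  rw [runTape_eq, h, List.getD_append_right _ _ _ _ le_rfl]
  cases post <;> simp

/-- The symbols passed over belong to moves of the simulator itself. These come from moves of `M`
that are already in the simulated run, so they must not be copied. -/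
theorem reaches_skip (skip : List RunSym) (c : Service) (pre rest : List RunSym)
    (ht : text c.run = pre ++ (skip ++ rest)) (hs : RunSym.label .bot ∉ skip) :
    Reaches { c with state := 4, realHead := pre.length }
      { c with state := 4, realHead := (pre ++ skip).length } := by
  induction skip generalizing pre with
  | nil => simpa using Reaches.refl _
  | cons σ skip ih =>
    have h1 : sym { c with state := 4, realHead := pre.length } = σ.code := by
      simp [sym, src, runTape_of_text ht]
    have h2 : σ.code ≠ 0 := text_ne_blank (Φ := c.run) (by rw [ht]; simp)
    have h3 : σ.code ≠ 97 := by
      intro h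
      have : σ = .label .bot := RunSym.code_injective h
      simp [this] at hs
    refine Reaches.step ⟨by simp, by rw [h1]; simpa [src] using σ.code_lt⟩ ?_
    rw [Service.step, h1]
    simp only [prog, h2, h3, if_false]
    have := ih (pre ++ [σ]) (by rw [ht]; simp) (fun h => hs (List.mem_cons_of_mem _ h))
    simpa [apply, write, Dir.shift] using this

/-- The move to be copied is the last one on the run tape, so its end is recognized by the blank. -/
theorem reaches_copy (α : Move) (c : Service) (pre : List RunSym) (l : List ℕ)
    (ht : text c.run = pre ++ α.map RunSym.key) :
    Reaches { c with state := 10, realHead := pre.length, simRun := tape l, runHead := l.length }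
      { c with
        state := 11, realHead := (text c.run).length, simRun := tape (l ++ moveCode α)
        runHead := (l ++ moveCode α).length } := by
  induction α generalizing pre l with
  | nil =>
    have h1 : sym { c with
        state := 10, realHead := pre.length, simRun := tape l, runHead := l.length } = 0 := by
      simp [sym, src, runTape_of_text ht, RunSym.code]
    refine Reaches.step ⟨by simp, by rw [h1]; simp [src]⟩ ?_
    rw [Service.step, h1]
    rw [ht]
    simpa [moveCode, apply, prog, write, Dir.shift] using Reaches.refl _
  | cons k α ih =>
    have h1 : sym { c with
        state := 10, realHead := pre.length, simRun := tape l, runHead := l.length }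
          = k.val + 1 := by
      simp [sym, src, runTape_of_text ht, RunSym.code]
    have hk := k.2
    refine Reaches.step ⟨by simp, by rw [h1]; simp [src]; omega⟩ ?_
    rw [Service.step, h1]
    have := ih (pre ++ [.key k]) (l ++ [k.val + 1]) (by rw [ht]; simp)
    simpa [apply, prog, write, Dir.shift, update_tape, moveCode] using this

/-- The content of the fourth service tape: the number `n` in unary. -/
def unary (n : ℕ) : ℕ → ℕ := fun j => if j = 0 then 2 else if j ≤ n then 1 else 0

/-- The counter is crossed from right to left. Each `1` yields a digit `0`, whose code is `17`; the
`2` in cell `0` ends the loop. -/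
theorem reaches_zeros (n k : ℕ) (hk : k ≤ n) (c : Service) (l : List ℕ) :
    Reaches { c with
        state := 7, count := unary n, countHead := k, simRun := tape l, runHead := l.length }
      { c with
        state := 8, count := unary n, countHead := 1, simRun := tape (l ++ List.replicate k 17)
        runHead := (l ++ List.replicate k 17).length } := by
  induction k generalizing l with
  | zero =>
    have h1 : sym { c with
        state := 7, count := unary n, countHead := 0, simRun := tape l
        runHead := l.length } = 2 := by
      simp [sym, src, unary]
    refine Reaches.step ⟨by simp, by rw [h1]; simp [src]⟩ ?_
    rw [Service.step, h1]
    simpa [apply, prog, write, Dir.shift] using Reaches.refl _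
  | succ k ih =>
    have h1 : sym { c with
        state := 7, count := unary n, countHead := k + 1, simRun := tape l
        runHead := l.length } = 1 := by
      simp [sym, src, unary, hk]
    refine Reaches.step ⟨by simp, by rw [h1]; simp [src]⟩ ?_
    rw [Service.step, h1]
    have := ih (by omega) (l ++ [17])
    simpa [apply, prog, write, Dir.shift, update_tape, List.replicate_succ] using this

theorem reaches_countEnd (n k i : ℕ) (hi : i + k = n + 1) (h0 : 0 < i) (c : Service) :
    Reaches { c with state := 8, count := unary n, countHead := i }
      { c with state := 9, count := unary n, countHead := n + 1 } := by
  induction k generalizing i with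
  | zero =>
    obtain rfl : i = n + 1 := by omega
    have h1 : sym { c with state := 8, count := unary n, countHead := n + 1 } = 0 := by
      simp [sym, src, unary]
    refine Reaches.step ⟨by simp, by rw [h1]; simp [src]⟩ ?_
    rw [Service.step, h1]
    exact Reaches.refl _
  | succ k ih =>
    have h1 : sym { c with state := 8, count := unary n, countHead := i } = 1 := by
      have h2 : i ≠ 0 := by omega
      have h3 : i ≤ n := by omega
      simp [sym, src, unary, h2, h3]
    refine Reaches.step ⟨by simp, by rw [h1]; simp [src]⟩ ?_
    rw [Service.step, h1]
    exact ih (i + 1) (by omega) (by omega)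

/-- The move `1;0…0.α` with `n` zeros. -/
def _root_.CoL.zeroMove (n : ℕ) (α : Move) : Move :=
  [digitKey 1, semicolonKey] ++ (List.replicate n (digitKey 0) ++ (dotKey :: α))

theorem reaches_env (env : List Move) (henv : env.length ≤ 1) (n : ℕ) (c : Service)
    (pre : List RunSym) (l : List ℕ)
    (ht : text c.run = pre ++ text (env.map fun α => (Player.bot, α))) :
    Reaches { c with
        state := 4, realHead := pre.length, simRun := tape l, runHead := l.length
        count := unary n, countHead := n + 1 }
      { c with
        state := 11, realHead := (text c.run).length
        simRun := tape (l ++ textCode (env.map fun α => (Player.bot, zeroMove n α)))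
        runHead := (l ++ textCode (env.map fun α => (Player.bot, zeroMove n α))).length
        count := unary n, countHead := n + 1 } := by
  match env, henv with
  | [], _ =>
    have h1 : sym { c with
        state := 4, realHead := pre.length, simRun := tape l, runHead := l.length
        count := unary n, countHead := n + 1 } = 0 := by
      simp [sym, src, runTape_of_text ht, RunSym.code, text]
    refine Reaches.step ⟨by simp, by rw [h1]; simp [src]⟩ ?_
    rw [Service.step, h1]
    rw [ht]
    simpa [textCode, text, apply, prog, write, Dir.shift] using Reaches.refl _
  | [α], _ =>
    have ht' : text c.run = pre ++ (RunSym.label .bot :: α.map RunSym.key) := by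
      rw [ht]; simp [text]
    have h1 : sym { c with
        state := 4, realHead := pre.length, simRun := tape l, runHead := l.length
        count := unary n, countHead := n + 1 } = 97 := by
      simp [sym, src, runTape_of_text ht', RunSym.code]
    refine Reaches.step ⟨by simp, by rw [h1]; simp [src]⟩ ?_
    rw [Service.step, h1]
    -- In these three states the symbol is irrelevant for the action, but the rules still ask for
    -- one in the range of the table. It is the blank after `l`.
    have ready : ∀ p, (p = 5 ∨ p = 6 ∨ p = 9) → ∀ d : Service, d.state = p →
        ∀ l : List ℕ, d.simRun = tape l → d.runHead = l.length → d.Ready := by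
      rintro p hp d hd l hl hr
      refine ⟨by omega, ?_⟩
      rcases hp with rfl | rfl | rfl <;> simp [sym, hd, src, hl, hr, tape]
    simp only [apply, prog, write, Dir.shift, update_tape]
    have e : ∀ (l : List ℕ) (s : ℕ), l.length + 1 = (l ++ [s]).length := by simp
    refine Reaches.step (ready 5 (by simp) _ rfl (l ++ [97]) rfl (by simp)) ?_
    simp only [Service.step, apply, prog, write, Dir.shift]
    simp only [show ¬ ((97:ℕ) = 0) by decide, if_false, if_true]
    rw [e l 97, update_tape, e _ 18]
    refine Reaches.step (ready 6 (by simp) _ rfl (l ++ [97] ++ [18]) rfl rfl) ?_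
    simp only [Service.step, apply, prog, write, Dir.shift]
    rw [update_tape, e _ 28]
    refine (reaches_zeros n n le_rfl { c with realHead := pre.length + 1 } _).trans ?_
    refine (reaches_countEnd n n 1 (by omega) (by omega) { c with
        realHead := pre.length + 1
        simRun := tape (l ++ [97] ++ [18] ++ [28] ++ List.replicate n 17)
        runHead := (l ++ [97] ++ [18] ++ [28] ++ List.replicate n 17).length }).trans ?_
    refine Reaches.step (ready 9 (by simp) _ rfl _ rfl rfl) ?_
    simp only [Service.step, apply, prog, write, Dir.shift]
    rw [update_tape, e _ 15]
    have h2 := reaches_copy α { c with count := unary n, countHead := n + 1 }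
      (pre ++ [.label .bot]) (l ++ [97] ++ [18] ++ [28] ++ List.replicate n 17 ++ [15])
      (by rw [ht']; simp)
    -- The numbers are the codes of the label of the environment and of the keys `1`, `;`, `0` and
    -- the period.
    have e2 : l ++ [97] ++ [18] ++ [28] ++ List.replicate n 17 ++ [15] ++ moveCode α =
        l ++ textCode ([α].map fun α => (Player.bot, zeroMove n α)) := by
      simp only [List.map_cons, List.map_nil, textCode_singleton]
      simp [zeroMove, moveCode, RunSym.code, digitKey, semicolonKey, dotKey]
    rw [e2] at h2
    simpa using h2

end Service

/-! ### Making the prepared moves -/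

/-- The rest of a move after the prefix that takes the recognizer from state `a` to the accepting
state, if there is one. -/
def scan : ℕ → Move → Option Move
  | a, [] => if a = 3 then some [] else none
  | a, k :: m => (scan (recognize a (k.val + 1)) m).map fun β => if a = 3 then k :: β else β

theorem scan_three (m : Move) : scan 3 m = some m := by
  induction m with
  | nil => rfl
  | cons k m ih => simp [scan, recognize, ih]

/-- The labmoves that the simulator makes for a move of the simulated machine. -/
def visible (x : LabMove) : Option LabMove := (scan 0 x.2).map fun β => (x.1, β)

/-- Closed moves as spelled on the tape of prepared moves. -/
def blockCode (ms : List Move) : List ℕ := ms.flatMap fun m => moveCode m ++ [98]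

/-- The labmoves of the machine for a list of moves. -/
def topMoves (ms : List Move) : Position := ms.map fun m => (Player.top, m)

theorem moveCode_bounds {m : Move} {s : ℕ} (h : s ∈ moveCode m) : s ≠ 0 ∧ s < 96 := by
  obtain ⟨k, -, rfl⟩ := List.mem_map.1 h
  have := k.2
  omega

theorem blockCode_bounds {ms : List Move} {s : ℕ} (h : s ∈ blockCode ms) : s ≠ 0 ∧ s < 99 := by
  obtain ⟨m, -, h⟩ := List.mem_flatMap.1 h
  rcases List.mem_append.1 h with h | h
  · have := moveCode_bounds h
    omega
  · simp at h; omega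

theorem recognize_lt {a : ℕ} (s : ℕ) : recognize a s < 5 := by
  unfold recognize; split_ifs <;> omega

namespace Service

/-- The states `15` to `19` fall under the default case of `prog`; the offset from `15` is the state
of the recognizer. -/
theorem prog_scan {a : ℕ} (ha : a < 5) (s : ℕ) :
    prog (15 + a) s = if s = 98 then
        { dirMove := .right, action := if a = 3 then .make else .idle, next := 14 }
      else
        { writeRun := some s, dirRun := .right, dirMove := .right,
          action := if a = 3 then .type (Fin.ofNat 95 (s - 1)) else .idle,
          next := 15 + recognize a s } := by
  interval_cases a <;> simp [prog]

theorem src_scan {a : ℕ} (ha : a < 5) : src (15 + a) = 2 := by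
  interval_cases a <;> rfl

/-- All keys are copied to the simulated run, but a key is typed only when the recognizer is already
in its accepting state `3`, which it never leaves. So nothing is typed before the prefix is
complete, and a rejected move leaves nothing behind. -/
theorem reaches_scan (m : Move) (a : ℕ) (ha : a < 5) (c : Service) (f : ℕ → ℕ) (p : ℕ)
    (rest l : List ℕ) (hf : Spells f p (moveCode m ++ 98 :: rest)) (t : Move)
    (ht : a ≠ 3 → t = []) (Φ : Position) :
    Reaches { c with
        state := 15 + a, moves := f, moveHead := p, simRun := tape l, runHead := l.length
        typed := t, run := Φ }
      { c with
        state := 14, moves := f, moveHead := p + (moveCode m ++ [98]).length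
        simRun := tape (l ++ moveCode m), runHead := (l ++ moveCode m).length
        typed := [], run := Φ ++ ((scan a m).map fun β => (Player.top, t ++ β)).toList } := by
  induction m generalizing a p l t with
  | nil =>
    have h0 : f p = 98 := hf.head
    have hs : sym { c with
        state := 15 + a, moves := f, moveHead := p, simRun := tape l, runHead := l.length
        typed := t, run := Φ } = 98 := by
      simp [sym, src_scan ha, h0]
    refine Reaches.step ⟨by simp; omega, by rw [hs]; simp [src_scan ha]⟩ ?_
    rw [Service.step, hs]
    simp only [prog_scan ha]
    by_cases h3 : a = 3
    · subst h3
      simpa [apply, write, Dir.shift, moveCode, scan] using Reaches.refl _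
    · have := ht h3
      subst this
      simpa [apply, write, Dir.shift, moveCode, scan, h3] using Reaches.refl _
  | cons k m ih =>
    have h0 : f p = k.val + 1 := hf.head
    have hk := k.2
    have hs : sym { c with
        state := 15 + a, moves := f, moveHead := p, simRun := tape l, runHead := l.length
        typed := t, run := Φ } = k.val + 1 := by
      simp [sym, src_scan ha, h0]
    refine Reaches.step ⟨by simp; omega, by rw [hs]; simp [src_scan ha]; omega⟩ ?_
    rw [Service.step, hs]
    simp only [prog_scan ha]
    rw [if_neg (by omega)]
    have htail : Spells f (p + 1) (moveCode m ++ 98 :: rest) := hf.tail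
    by_cases h3 : a = 3
    · subst h3
      have h4 := ih 3 (by omega) (p + 1) (l ++ [k.val + 1]) htail (t ++ [k]) (by simp)
      have hfin : Fin.ofNat 95 k.val = k := by
        apply Fin.ext; simp
      simp only [scan_three, Option.map_some, Option.toList_some, List.append_assoc,
        List.singleton_append] at h4 ⊢
      have e : p + (moveCode (k :: m) ++ [98]).length
          = p + 1 + (moveCode m ++ [98]).length := by
        simp [moveCode]; omega
      rw [e]
      simpa [apply, write, Dir.shift, update_tape, moveCode, recognize, hfin] using h4
    · have := ht h3
      subst this
      have h4 := ih (recognize a (k.val + 1)) (recognize_lt _) (p + 1) (l ++ [k.val + 1]) htail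
        [] (fun _ => rfl)
      have e : p + (moveCode (k :: m) ++ [98]).length
          = p + 1 + (moveCode m ++ [98]).length := by
        simp [moveCode]; omega
      rw [e]
      simpa [apply, write, Dir.shift, update_tape, moveCode, scan, h3] using h4

/-- Moves that have been dealt with are not erased. A fresh marker `99` is put behind them, and
since rewinding stops at the first `99`, what lies to its left is never read again. -/
theorem reaches_moves (ms : List Move) (c : Service) (f : ℕ → ℕ) (p : ℕ) (l : List ℕ)
    (hf : Spells f p (blockCode ms)) (Φ : Position) :
    Reaches { c with
        state := 14, moves := f, moveHead := p, simRun := tape l, runHead := l.length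
        typed := [], run := Φ }
      { c with
        state := 20, moves := Function.update f (p + (blockCode ms).length) 99
        moveHead := p + (blockCode ms).length + 1
        simRun := tape (l ++ textCode (topMoves ms))
        runHead := (l ++ textCode (topMoves ms)).length
        typed := [], run := Φ ++ (topMoves ms).filterMap visible } := by
  induction ms generalizing p l Φ with
  | nil =>
    have h0 : f p = 0 := hf.head_nil
    have hs : sym { c with
        state := 14, moves := f, moveHead := p, simRun := tape l, runHead := l.length
        typed := [], run := Φ } = 0 := by
      simp [sym, src, h0]
    refine Reaches.step ⟨by simp, by rw [hs]; simp [src]⟩ ?_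
    rw [Service.step, hs]
    simpa [apply, prog, write, Dir.shift, blockCode, topMoves, textCode, text] using
      Reaches.refl _
  | cons m ms ih =>
    have hf' : Spells f p (moveCode m ++ 98 :: blockCode ms) := by
      simpa [blockCode] using hf
    -- If `m` is empty, the scanned symbol is the closing `98`, so an empty move is not mistaken for
    -- the end of the list.
    have h0 : f p ≠ 0 ∧ f p < 102 := by
      have hh := hf' 0
      simp only [Nat.add_zero] at hh
      rw [hh]
      cases m with
      | nil => simp [moveCode]
      | cons k m =>
        have := k.2
        simp [moveCode]; omega
    have hs : sym { c with
        state := 14, moves := f, moveHead := p, simRun := tape l, runHead := l.length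
        typed := [], run := Φ } = f p := by
      simp [sym, src]
    refine Reaches.step ⟨by simp, by rw [hs]; simpa [src] using h0.2⟩ ?_
    rw [Service.step, hs]
    have h1 := reaches_scan m 0 (by omega) c f p (blockCode ms) (l ++ [96]) hf' [] (fun _ => rfl) Φ
    have hf2 : Spells f (p + (moveCode m ++ [98]).length) (blockCode ms) := by
      apply Spells.drop
      simpa using hf'
    have h2 := ih (p + (moveCode m ++ [98]).length) (l ++ [96] ++ moveCode m) hf2
      (Φ ++ ((scan 0 m).map fun β => (Player.top, [] ++ β)).toList)
    have h3 := h1.trans h2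
    have e1 : l ++ [96] ++ moveCode m ++ textCode (topMoves ms)
        = l ++ textCode (topMoves (m :: ms)) := by
      have : topMoves (m :: ms) = [(Player.top, m)] ++ topMoves ms := rfl
      rw [this, textCode_append, textCode_singleton]
      simp [RunSym.code]
    have e2 : p + (moveCode m ++ [98]).length + (blockCode ms).length
        = p + (blockCode (m :: ms)).length := by
      simp [blockCode]; omega
    have e3 : Φ ++ ((scan 0 m).map fun β => (Player.top, [] ++ β)).toList
          ++ (topMoves ms).filterMap visible
        = Φ ++ (topMoves (m :: ms)).filterMap visible := by
      have : topMoves (m :: ms) = (Player.top, m) :: topMoves ms := rfl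
      rw [this, List.filterMap_cons, visible]
      cases scan 0 m <;> simp
    rw [e1, e2, e3] at h3
    simpa [apply, prog, write, Dir.shift, h0.1, update_tape] using h3

theorem reaches_rewind (f : ℕ → ℕ) (b k : ℕ) (hb : f b = 99)
    (hk : ∀ j, b < j → j ≤ b + k → f j ≠ 99 ∧ f j < 102) (c : Service) :
    Reaches { c with state := 13, moves := f, moveHead := b + k }
      { c with state := 14, moves := f, moveHead := b + 1 } := by
  induction k with
  | zero =>
    have hs : sym { c with state := 13, moves := f, moveHead := b + 0 } = 99 := by
      simp [sym, src, hb]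
    refine Reaches.step ⟨by simp, by rw [hs]; simp [src]⟩ ?_
    rw [Service.step, hs]
    exact Reaches.refl _
  | succ k ih =>
    have h := hk (b + (k + 1)) (by omega) le_rfl
    have hs : sym { c with state := 13, moves := f, moveHead := b + (k + 1) }
        = f (b + (k + 1)) := by
      simp [sym, src]
    refine Reaches.step ⟨by simp, by rw [hs]; simpa [src] using h.2⟩ ?_
    rw [Service.step, hs]
    simp only [prog, h.1, if_false]
    exact ih fun j h1 h2 => hk j h1 (by omega)

/-- Going back to the start of the prepared moves. -/
theorem reaches_rewind_of_spells (f : ℕ → ℕ) (b : ℕ) (l : List ℕ) (hb : Spells f b (99 :: l))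
    (hl : ∀ s ∈ l, s < 99) (k : ℕ) (hk : k ≤ l.length) (c : Service) :
    Reaches { c with state := 13, moves := f, moveHead := b + k }
      { c with state := 14, moves := f, moveHead := b + 1 } := by
  refine reaches_rewind f b k hb.head (fun j h1 h2 => ?_) c
  obtain ⟨i, rfl⟩ : ∃ i, j = b + 1 + i := ⟨j - (b + 1), by omega⟩
  rw [hb.tail i, List.getD_eq_getElem _ _ (by omega)]
  have := hl _ (List.getElem_mem (by omega : i < l.length))
  omega

/-- A block-move machine makes its closed moves only and discards the keys typed since the last
`close`. These are erased backwards up to a `98` or `99`, which cannot occur among them because the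
codes of keys are below `96`. -/
theorem reaches_erase (m : List ℕ) (hm : ∀ s ∈ m, s < 96) (ms : List Move) (f : ℕ → ℕ) (b : ℕ)
    (hf : Spells f b (99 :: (blockCode ms ++ m))) (c : Service) :
    ∃ f', Spells f' b (99 :: blockCode ms) ∧
      Reaches { c with state := 12, moves := f, moveHead := b + (blockCode ms ++ m).length }
        { c with state := 13, moves := f', moveHead := b + (blockCode ms).length } := by
  induction m using List.reverseRecOn generalizing f with
  | nil =>
    rw [List.append_nil] at hf ⊢
    refine ⟨f, hf, ?_⟩
    -- The stopping symbol is the end of the last closed move, or the left marker if no move is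
    -- closed.
    have h0 : f (b + (blockCode ms).length) = 98 ∨ f (b + (blockCode ms).length) = 99 := by
      rw [hf]
      rcases List.eq_nil_or_concat ms with rfl | ⟨ms', m, rfl⟩
      · simp [blockCode]
      · left
        have : (99 :: blockCode (ms'.concat m))
            = (99 :: (blockCode ms' ++ moveCode m)) ++ [98] := by
          simp [blockCode]
        have hlen : (blockCode (ms'.concat m)).length
            = (99 :: (blockCode ms' ++ moveCode m)).length := by
          have h := congrArg List.length this
          rw [List.length_append, List.length_cons, List.length_singleton] at h
          omega
        rw [this, hlen, List.getD_append_right _ _ _ _ le_rfl]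
        simp
    have hs : sym { c with state := 12, moves := f, moveHead := b + (blockCode ms).length }
        = f (b + (blockCode ms).length) := by
      simp [sym, src]
    refine Reaches.step ⟨by simp, by rw [hs]; simp only [src]; split_ifs <;> omega⟩ ?_
    rw [Service.step, hs]
    simp only [prog, h0, if_true]
    exact Reaches.refl _
  | append_singleton m s ih =>
    have hsm := hm s (by simp)
    have hf1 : Spells f b ((99 :: (blockCode ms ++ m)) ++ [s]) := by simpa using hf
    have h0 : f (b + (blockCode ms ++ (m ++ [s])).length) = s := by
      rw [hf1, List.getD_append_right _ _ _ _ (by simp)]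
      simp [← Nat.add_assoc]
    have e : b + (99 :: (blockCode ms ++ m)).length
        = b + (blockCode ms ++ (m ++ [s])).length := by
      simp; omega
    have hf2 := hf1.pop
    rw [e] at hf2
    obtain ⟨f', hf', hr⟩ := ih (fun s hs => hm s (by simp [hs])) _ hf2
    refine ⟨f', hf', ?_⟩
    have hs : sym { c with
        state := 12, moves := f, moveHead := b + (blockCode ms ++ (m ++ [s])).length } = s := by
      simp only [sym, src]; simpa using h0
    refine Reaches.step ⟨by simp, by rw [hs]; simp [src]; omega⟩ ?_
    rw [Service.step, hs]
    have hn : ¬ (s = 98 ∨ s = 99) := by omega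
    simp only [prog, hn, if_false, apply, write, Dir.shift]
    have e2 : b + (blockCode ms ++ (m ++ [s])).length - 1 = b + (blockCode ms ++ m).length := by
      simp; omega
    rw [e2]
    exact hr

/-- The moves that are made at the end of the service routine, in dependence on the kind. -/
theorem reaches_flush (κ : Kind) (c : Service) (f : ℕ → ℕ) (b : ℕ) (l : List ℕ) (block : List Move)
    (m : Move) (hκ : κ ≠ .bmepm → block = [])
    (hf : Spells f b ((99 :: (blockCode block ++ moveCode m)) ++
      [if κ = .bmepm then 101 else 100])) (Φ : Position) :
    ∃ f' b', Spells f' b' [99] ∧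
      Reaches { c with
          state := 11, moves := f, moveHead := b + 1 + (blockCode block ++ moveCode m).length
          simRun := tape l, runHead := l.length, typed := [], run := Φ }
        { c with
          state := 20, moves := f', moveHead := b' + 1
          simRun := tape (l ++ textCode (topMoves (if κ = .bmepm then block else [m])))
          runHead := (l ++ textCode (topMoves (if κ = .bmepm then block else [m]))).length
          typed := []
          run := Φ ++ (topMoves (if κ = .bmepm then block else [m])).filterMap visible } := by
  have main : ∀ (f : ℕ → ℕ) (ms : List Move), Spells f b (99 :: blockCode ms) →
      ∃ f' b', Spells f' b' [99] ∧
        Reaches { c with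
            state := 14, moves := f, moveHead := b + 1
            simRun := tape l, runHead := l.length, typed := [], run := Φ }
          { c with
            state := 20, moves := f', moveHead := b' + 1
            simRun := tape (l ++ textCode (topMoves ms))
            runHead := (l ++ textCode (topMoves ms)).length
            typed := []
            run := Φ ++ (topMoves ms).filterMap visible } := by
    intro f ms hf
    refine ⟨_, b + 1 + (blockCode ms).length, ?_, reaches_moves ms c f (b + 1) l hf.tail Φ⟩
    have h1 := Spells.append (hf.tail) 99
    exact Spells.drop h1
  have hend : f (b + 1 + (blockCode block ++ moveCode m).length)
      = if κ = .bmepm then 101 else 100 := by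
    have := hf.drop.head
    rw [← this]
    congr 1
    simp; omega
  have hs : sym { c with
      state := 11, moves := f, moveHead := b + 1 + (blockCode block ++ moveCode m).length
      simRun := tape l, runHead := l.length, typed := [], run := Φ }
      = if κ = .bmepm then 101 else 100 := by
    simp only [sym, src]; simpa using hend
  have hready : Ready { c with
      state := 11, moves := f, moveHead := b + 1 + (blockCode block ++ moveCode m).length
      simRun := tape l, runHead := l.length, typed := [], run := Φ } :=
    ⟨by simp, by rw [hs]; simp only [src]; split_ifs <;> omega⟩
  by_cases hk : κ = .bmepm
  · simp only [hk, if_true] at hs hf ⊢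
    have hf2 := hf.pop
    have e : b + (99 :: (blockCode block ++ moveCode m)).length
        = b + 1 + (blockCode block ++ moveCode m).length := by
      simp; omega
    rw [e] at hf2
    obtain ⟨f1, hf1, hr1⟩ := reaches_erase (moveCode m)
      (fun s hs => (moveCode_bounds hs).2) block _ b hf2
      { c with simRun := tape l, runHead := l.length, typed := [], run := Φ }
    obtain ⟨f2, b2, hf2', hr2⟩ := main f1 block hf1
    refine ⟨f2, b2, hf2', Reaches.step hready ?_⟩
    rw [Service.step, hs]
    have e2 : b + 1 + (blockCode block ++ moveCode m).length - 1
        = b + (blockCode block ++ moveCode m).length := by omega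
    have hw := reaches_rewind_of_spells f1 b (blockCode block) hf1
      (fun s hs => (blockCode_bounds hs).2) _ le_rfl
      { c with simRun := tape l, runHead := l.length, typed := [], run := Φ }
    have h := (hr1.trans hw).trans hr2
    rw [← e2] at h
    simpa [apply, prog, write, Dir.shift] using h
  · have hbl := hκ hk
    subst hbl
    simp only [hk, if_false] at hs hf ⊢
    have e : b + (99 :: (blockCode [] ++ moveCode m)).length
        = b + 1 + (blockCode [] ++ moveCode m).length := by
      simp; omega
    -- For the other two kinds the typed move is the one to be made: overwriting `100` by `98`
    -- closes it and turns it into a block of one move.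
    have hf0 : Spells (Function.update f (b + 1 + (blockCode [] ++ moveCode m).length) 98) b
        (99 :: blockCode [m]) := by
      have h1 := hf.pop.append 98
      rw [Function.update_idem, e] at h1
      simpa [blockCode] using h1
    obtain ⟨f2, b2, hf2', hr2⟩ := main _ [m] hf0
    refine ⟨f2, b2, hf2', Reaches.step hready ?_⟩
    rw [Service.step, hs]
    have hw := reaches_rewind_of_spells _ b (blockCode [m]) hf0
      (fun s hs => (blockCode_bounds hs).2) (1 + (blockCode [] ++ moveCode m).length)
      (by simp [blockCode]; omega)
      { c with simRun := tape l, runHead := l.length, typed := [], run := Φ }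
    have h := hw.trans hr2
    rw [← Nat.add_assoc] at h
    simpa [apply, prog, write, Dir.shift] using h

end Service

/-! ### One cycle of the simulation -/

namespace Service

/-- The moves made on a cycle with action `a`. -/
def _root_.CoL.madeMoves (κ : Kind) (a : Action) (C : Config) : List Move :=
  if a = .make then (if κ = .bmepm then C.block else [C.typed]) else []

theorem reaches_act (κ : Kind) (a : Action) (C : Config) (hκ : κ ≠ .bmepm → C.block = [])
    (c : Service) (f : ℕ → ℕ) (b : ℕ) (l : List ℕ)
    (hf : Spells f b (99 :: (blockCode C.block ++ moveCode C.typed))) (Φ : Position) :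
    ∃ f' b', Spells f' b' (99 :: (blockCode (Machine.applyAction κ a C).block ++
        moveCode (Machine.applyAction κ a C).typed)) ∧
      Reaches { c with
          state := 11
          moves := write f (b + 1 + (blockCode C.block ++ moveCode C.typed).length)
            (moveOp κ a).write
          moveHead := (moveOp κ a).dir.shift
            (b + 1 + (blockCode C.block ++ moveCode C.typed).length)
          simRun := tape l, runHead := l.length, typed := [], run := Φ }
        { c with
          state := 20, moves := f'
          moveHead := b' + 1 + (blockCode (Machine.applyAction κ a C).block ++
            moveCode (Machine.applyAction κ a C).typed).length
          simRun := tape (l ++ textCode (topMoves (madeMoves κ a C)))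
          runHead := (l ++ textCode (topMoves (madeMoves κ a C))).length
          typed := []
          run := Φ ++ (topMoves (madeMoves κ a C)).filterMap visible } := by
  -- Only `make` leaves a symbol under the head. After any other action the scanned cell is blank,
  -- and the fetch step has already brought the tape of prepared moves up to date.
  have quiet : ∀ (f : ℕ → ℕ) (l' : List ℕ) (p : ℕ), Spells f b (99 :: l') →
      p = b + 1 + l'.length →
      Reaches { c with
          state := 11, moves := f, moveHead := p
          simRun := tape l, runHead := l.length, typed := [], run := Φ }
        { c with
          state := 20, moves := f, moveHead := p
          simRun := tape l, runHead := l.length, typed := [], run := Φ } := by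
    rintro f l' _ hf rfl
    have h0 : f (b + 1 + l'.length) = 0 := by rw [hf.tail]; simp
    have hs : sym { c with
        state := 11, moves := f, moveHead := b + 1 + l'.length
        simRun := tape l, runHead := l.length, typed := [], run := Φ } = 0 := by
      simp [sym, src, h0]
    refine Reaches.step ⟨by simp, by rw [hs]; simp [src]⟩ ?_
    rw [Service.step, hs]
    exact Reaches.refl _
  have e : b + (99 :: (blockCode C.block ++ moveCode C.typed)).length
      = b + 1 + (blockCode C.block ++ moveCode C.typed).length := by
    simp; omega
  have htext : textCode [] = [] := rfl
  have happ : ∀ s, Spells (Function.update f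
      (b + 1 + (blockCode C.block ++ moveCode C.typed).length) s) b
      (99 :: (blockCode C.block ++ moveCode C.typed) ++ [s]) := by
    intro s
    have := hf.append s
    rwa [e] at this
  rcases a with _ | k | _ | _ | _
  · refine ⟨f, b, hf, ?_⟩
    simpa [madeMoves, htext, topMoves, moveOp, write, Dir.shift, Machine.applyAction] using
      quiet f _ _ hf rfl
  · have h1 : Spells (Function.update f
        (b + 1 + (blockCode C.block ++ moveCode C.typed).length) (k.val + 1)) b
        (99 :: (blockCode C.block ++ moveCode (C.typed ++ [k]))) := by
      simpa [moveCode] using happ (k.val + 1)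
    refine ⟨_, b, h1, ?_⟩
    have h2 := quiet _ _ _ h1 rfl
    simpa [madeMoves, htext, topMoves, moveOp, write, Dir.shift, Machine.applyAction, moveCode,
      ← Nat.add_assoc] using h2
  · by_cases hk : κ = .bmepm
    · subst hk
      have h1 : Spells (Function.update f
        (b + 1 + (blockCode C.block ++ moveCode C.typed).length) 98) b
          (99 :: (blockCode (C.block ++ [C.typed]) ++ moveCode [])) := by
        simpa [moveCode, blockCode] using happ 98
      refine ⟨_, b, h1, ?_⟩
      have h2 := quiet _ _ _ h1 rfl
      simpa [madeMoves, htext, topMoves, moveOp, write, Dir.shift, Machine.applyAction, moveCode,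
        blockCode, ← Nat.add_assoc] using h2
    · refine ⟨f, b, by simpa [Machine.applyAction, hk] using hf, ?_⟩
      simpa [madeMoves, htext, topMoves, moveOp, write, Dir.shift, Machine.applyAction, hk] using
        quiet f _ _ hf rfl
  · obtain ⟨f', b', h1, h2⟩ := reaches_flush κ c _ b l C.block C.typed hκ
      (happ (if κ = .bmepm then 101 else 100)) Φ
    refine ⟨f', b', by simpa [Machine.applyAction, blockCode, moveCode] using h1, ?_⟩
    have h3 : (moveOp κ .make) = ⟨none, some (if κ = .bmepm then 101 else 100), .stay⟩ := by
      unfold moveOp; split_ifs <;> rfl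
    rw [h3]
    simpa [madeMoves, write, Dir.shift, Machine.applyAction, blockCode, moveCode] using h2
  · refine ⟨f, b, hf, ?_⟩
    simpa [madeMoves, htext, topMoves, moveOp, write, Dir.shift, Machine.applyAction] using
      quiet f _ _ hf rfl

theorem textCode_bounds {Φ : Position} : ∀ s ∈ textCode Φ, s ≠ 0 ∧ s < 102 := by
  intro s hs
  obtain ⟨σ, hσ, rfl⟩ := List.mem_map.1 hs
  exact ⟨text_ne_blank hσ, by have := σ.code_lt; omega⟩

/-- The whole service routine. -/
theorem reaches_service (κ : Kind) (a : Action) (C : Config) (hκ : κ ≠ .bmepm → C.block = [])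
    (c : Service) (f : ℕ → ℕ) (b n h : ℕ)
    (hf : Spells f b (99 :: (blockCode C.block ++ moveCode C.typed))) (env : List Move)
    (henv : env.length ≤ 1) (Φ Ψ : Position) (pre skip : List RunSym)
    (hΦ : text Φ = pre ++ skip) (hskip : RunSym.label .bot ∉ skip) :
    ∃ f' b', Spells f' b' (99 :: (blockCode (Machine.applyAction κ a C).block ++
        moveCode (Machine.applyAction κ a C).typed)) ∧
      Reaches { c with
          state := 1
          simRun := tape (textCode Ψ), marks := startMark, runHead := h
          moves := write f (b + 1 + (blockCode C.block ++ moveCode C.typed).length)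
            (moveOp κ a).write
          moveHead := (moveOp κ a).dir.shift
            (b + 1 + (blockCode C.block ++ moveCode C.typed).length)
          count := unary n, countHead := n + 1
          realHead := pre.length, typed := []
          run := Φ ++ env.map fun α => (Player.bot, α) }
        { c with
          state := 30
          simRun := tape (textCode (Ψ ++ (env.map fun α => (Player.bot, zeroMove n α)) ++
            topMoves (madeMoves κ a C)))
          marks := startMark, runHead := h
          moves := f'
          moveHead := b' + 1 + (blockCode (Machine.applyAction κ a C).block ++
            moveCode (Machine.applyAction κ a C).typed).length
          count := unary n, countHead := n + 1
          realHead := (text (Φ ++ env.map fun α => (Player.bot, α))).length, typed := []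
          run := Φ ++ (env.map fun α => (Player.bot, α)) ++
            (topMoves (madeMoves κ a C)).filterMap visible } := by
  have ht : text (Φ ++ env.map fun α => (Player.bot, α))
      = pre ++ (skip ++ text (env.map fun α => (Player.bot, α))) := by
    rw [text_append, hΦ, List.append_assoc]
  obtain ⟨f', b', hf', hr⟩ := reaches_act κ a C hκ { c with
      marks := placeMark h, count := unary n, countHead := n + 1
      realHead := (text (Φ ++ env.map fun α => (Player.bot, α))).length } f b
    (textCode Ψ ++ textCode (env.map fun α => (Player.bot, zeroMove n α))) hf
    (Φ ++ env.map fun α => (Player.bot, α))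
  refine ⟨f', b', hf', ?_⟩
  set p := b + 1 + (blockCode C.block ++ moveCode C.typed).length
  have h1 := reaches_goToEnd (l := textCode Ψ) textCode_bounds { c with
          moves := write f p (moveOp κ a).write
          moveHead := (moveOp κ a).dir.shift p
          count := unary n, countHead := n + 1
          realHead := pre.length, typed := []
          run := Φ ++ env.map fun α => (Player.bot, α) } h
  have h2 := reaches_skip skip { c with
          simRun := tape (textCode Ψ), marks := placeMark h, runHead := (textCode Ψ).length
          moves := write f p (moveOp κ a).write
          moveHead := (moveOp κ a).dir.shift p
          count := unary n, countHead := n + 1, typed := []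
          run := Φ ++ env.map fun α => (Player.bot, α) } pre _ ht hskip
  have h3 := reaches_env env henv n { c with
          marks := placeMark h
          moves := write f p (moveOp κ a).write
          moveHead := (moveOp κ a).dir.shift p
          typed := []
          run := Φ ++ env.map fun α => (Player.bot, α) } (pre ++ skip) (textCode Ψ)
          (by rw [ht, List.append_assoc])
  have h4 := reaches_return { c with
          simRun := tape (textCode (Ψ ++ (env.map fun α => (Player.bot, zeroMove n α)) ++
            topMoves (madeMoves κ a C)))
          moves := f'
          moveHead := b' + 1 + (blockCode (Machine.applyAction κ a C).block ++
            moveCode (Machine.applyAction κ a C).typed).length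
          count := unary n, countHead := n + 1
          realHead := (text (Φ ++ env.map fun α => (Player.bot, α))).length, typed := []
          run := Φ ++ (env.map fun α => (Player.bot, α)) ++
            (topMoves (madeMoves κ a C)).filterMap visible } h
          (textCode (Ψ ++ (env.map fun α => (Player.bot, zeroMove n α)) ++
            topMoves (madeMoves κ a C))).length
  rw [textCode_append, textCode_append] at h4 ⊢
  exact (((h1.trans h2).trans h3).trans hr).trans h4

end Service

/-! ### The invariant of the simulation -/

/-- The move `1;w.α`. -/
def threadMove (w : List Bool) (α : Move) : Move :=
  [digitKey 1, semicolonKey] ++ (bitKeys w ++ (dotKey :: α))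

theorem zeroMove_eq (n : ℕ) (α : Move) : zeroMove n α = threadMove (List.replicate n false) α := by
  simp [zeroMove, threadMove, bitKeys]

/-- In all moves `1;w.α` of the position, `w` has at most the length `n`. -/
def ThreadBound (n : ℕ) (Φ : Position) : Prop :=
  ∀ x ∈ Φ, ∀ w α, x.2 = threadMove w α → w.length ≤ n

/-- Every move of the environment is of the form `1;0…0.α` with at least as many zeros as there are
bits in any earlier move. -/
def WellTimed (Φ : Position) : Prop :=
  ∀ Ψ m, Ψ ++ [(Player.bot, m)] <+: Φ → ∃ k α, m = zeroMove k α ∧ ThreadBound k Ψ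

/-- The configuration `D` of the simulator represents the configuration `C` after `n` cycles. -/
structure Simulates (κ : Kind) (n : ℕ) (C D : Config) : Prop where
  state : D.state = C.state + 32
  work : ∀ i, D.work (i + 5) = C.work i
  workHead : ∀ i, D.workHead (i + 5) = C.workHead i
  valHead : D.valHead = C.valHead
  simRun : D.work 0 = tape (textCode C.run)
  runHead : D.workHead 0 = C.runHead
  marks : D.work 1 = Service.startMark
  markHead : D.workHead 1 = C.runHead
  moves : ∃ b, Spells (D.work 2) b (99 :: (blockCode C.block ++ moveCode C.typed)) ∧
    D.workHead 2 = b + 1 + (blockCode C.block ++ moveCode C.typed).length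
  count : D.work 3 = Service.unary n
  countHead : D.workHead 3 = n + 1
  -- Whatever the real run head has not yet passed was made by the simulator, so the next label of
  -- the environment found from there on is a new move.
  real : ∃ pre post, text D.run = pre ++ post ∧ D.runHead = pre.length ∧
    RunSym.label .bot ∉ post
  typed : D.typed = []
  block : D.block = []
  run : D.run = C.run.filterMap visible
  simBlock : κ ≠ .bmepm → C.block = []
  -- The bounds on prepared moves prepare for `bound`: a move that has taken at most `n` cycles to
  -- type cannot contain a bitstring longer than `n`.
  typed_le : C.typed.length ≤ n
  block_le : ∀ m ∈ C.block, m.length ≤ n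
  bound : ThreadBound n C.run
  wellTimed : WellTimed C.run

theorem moveOp_read (κ : Kind) (a : Action) : (moveOp κ a).read = none := by
  unfold moveOp; split <;> (try split_ifs) <;> rfl

theorem fetchRule_op (κ : Kind) (r : Rule) (i : ℕ) : (fetchRule κ r).op (i + 5) = r.op i := by
  simp [fetchRule, Rule.op]

/-- The demand of `r` on the run tape reappears on work tape `0`, where it is equivalent because
`RunSym.code` is injective. The tapes `1` to `4` ask for nothing, and the tapes of `r` follow with a
shift by five. -/
theorem Simulates.applies {κ : Kind} {n : ℕ} {C D : Config} (h : Simulates κ n C D) (r : Rule)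
    (e : Valuation) : (fetchRule κ r).Applies e D ↔ r.Applies e C := by
  unfold Rule.Applies
  have h1 : (fetchRule κ r).state = D.state ↔ r.state = C.state := by
    rw [h.state]; simp [fetchRule]
  have h2 : (∀ i < (fetchRule κ r).work.length, ∀ s ∈ ((fetchRule κ r).op i).read,
      D.work i (D.workHead i) = s) ↔ (∀ s ∈ r.runRead, runTape C.run C.runHead = s) ∧
      (∀ i < r.work.length, ∀ s ∈ (r.op i).read, C.work i (C.workHead i) = s) := by
    have hlen : (fetchRule κ r).work.length = r.work.length + 5 := by simp [fetchRule]
    rw [hlen]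
    constructor
    · intro H
      constructor
      · intro s hs
        have := H 0 (by omega) s.code (by
          simp only [fetchRule, Rule.op, List.cons_append, List.getD_cons_zero]
          exact Option.mem_map_of_mem _ hs)
        rw [h.simRun, h.runHead, tape_textCode] at this
        exact RunSym.code_injective this
      · intro i hi s hs
        have := H (i + 5) (by omega) s (by rwa [fetchRule_op])
        rwa [h.work, h.workHead] at this
    · rintro ⟨H1, H2⟩ i hi s hs
      match i, hi, hs with
      | 0, _, hs =>
        simp only [fetchRule, Rule.op, List.cons_append, List.getD_cons_zero] at hs
        obtain ⟨σ, hσ, rfl⟩ := Option.mem_map.1 hs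
        rw [h.simRun, h.runHead, tape_textCode, H1 σ hσ]
      | 1, _, hs => simp [fetchRule, Rule.op] at hs
      | 2, _, hs => simp [fetchRule, Rule.op, moveOp_read] at hs
      | 3, _, hs => simp [fetchRule, Rule.op] at hs
      | 4, _, hs => simp [fetchRule, Rule.op] at hs
      | i + 5, hi, hs =>
        rw [fetchRule_op] at hs
        rw [h.work, h.workHead]
        exact H2 i (by omega) s hs
  rw [h1, h2]
  have h3 : (∀ s ∈ (fetchRule κ r).valRead, valTape e D.valHead = s) ↔
      (∀ s ∈ r.valRead, valTape e C.valHead = s) := by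
    rw [h.valHead]; rfl
  have h4 : ∀ s ∈ (fetchRule κ r).runRead, runTape D.run D.runHead = s := by
    intro s hs; simp [fetchRule] at hs
  rw [h3]
  tauto

/-- State numbers from `32` on exclude service and return rules. Among the fetch rules several may
apply; since the translation preserves the order of the table, the first one comes from the first
applicable rule of `M`. -/
theorem Simulates.rule? {M : Machine} {n : ℕ} {C D : Config} (h : Simulates M.kind n C D)
    (e : Valuation) : M.simulator.rule? e D = (M.rule? e C).map (fetchRule M.kind) := by
  unfold Machine.rule?
  have hst := h.state
  have h1 : serviceTable.find? (fun r => decide (r.Applies e D)) = none := by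
    rw [List.find?_eq_none]
    intro r hr happ
    obtain ⟨p, hp, hr⟩ := List.mem_flatMap.1 hr
    obtain ⟨s, -, rfl⟩ := List.mem_map.1 hr
    have := (of_decide_eq_true happ).1
    simp only [serviceRule] at this
    have := List.mem_range.1 hp
    omega
  have h2 : (M.table.map fun r => returnRule r.next).find? (fun r => decide (r.Applies e D))
      = none := by
    rw [List.find?_eq_none]
    intro r hr happ
    obtain ⟨p, hp, rfl⟩ := List.mem_map.1 hr
    have := (of_decide_eq_true happ).1
    simp only [returnRule] at this
    omega
  simp only [Machine.simulator, List.find?_append, h1, h2, Option.none_or, List.find?_map]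
  congr 2
  funext r
  simp only [Function.comp_apply, h.applies r e]

/-- The part of a configuration that belongs to the service routine. -/
def Service.ofConfig (D : Config) : Service where
  state := D.state
  simRun := D.work 0
  marks := D.work 1
  moves := D.work 2
  count := D.work 3
  runHead := D.workHead 0
  moveHead := D.workHead 2
  countHead := D.workHead 3
  realHead := D.runHead
  typed := D.typed
  run := D.run

theorem Service.toConfig_ofConfig {D : Config} (hh : D.workHead 1 = D.workHead 0)
    (hb : D.block = []) : (Service.ofConfig D).toConfig D = D := by
  obtain ⟨st, w, wh, run, rh, vh, ty, bl⟩ := D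
  simp only at hb hh
  subst hb
  simp only [toConfig, ofConfig, Config.mk.injEq, and_true, true_and]
  constructor
  · funext i
    rcases i with _ | _ | _ | _ | i <;> rfl
  · funext i
    rcases i with _ | _ | _ | _ | i <;> first | rfl | exact hh.symm

/-- As no permission is granted on the way, the moves of the environment are empty at each step and
the branch has only one continuation. -/
theorem Machine.IsBranch.eq_of_reaches {M : Machine} {e : Valuation} {B : ℕ → Config}
    (hB : M.simulator.IsBranch e B) {c d : Service} {base : Config} (h : c.Reaches d) {t : ℕ}
    (ht : B t = c.toConfig base) : ∃ t' ≥ t, B t' = d.toConfig base := by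
  induction h with
  | refl => exact ⟨t, le_rfl, ht⟩
  | tail _ hstep ih =>
    obtain ⟨t', hle, ht'⟩ := ih
    obtain ⟨hready, rfl⟩ := hstep
    refine ⟨t' + 1, by omega, ?_⟩
    obtain ⟨env, hal, hnext⟩ := hB.2 t'
    rw [ht'] at hal hnext
    have henv : env = [] := by
      by_contra hne
      exact Machine.not_grants_service hready (hal.2 hne)
    rw [hnext, henv, Machine.next_service hready]

/-- Every symbol of the next-state tape that can occur has a return rule. -/
theorem Machine.rule?_return {M : Machine} {e : Valuation} {D : Config} {r : Rule}
    (hr : r ∈ M.table) (hs : D.state = 30) (hq : D.work 4 (D.workHead 4) = r.next) :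
    M.simulator.rule? e D = some (returnRule r.next) := by
  have happ : ∀ q, (returnRule q).Applies e D ↔ D.work 4 (D.workHead 4) = q := by
    intro q
    constructor
    · intro h
      exact h.2.1 4 (by simp [returnRule]) q (by simp [returnRule, Rule.op])
    · intro h
      refine ⟨hs.symm, ?_, by simp [returnRule], by simp [returnRule]⟩
      intro i hi s hs
      simp only [returnRule, List.length_cons, List.length_nil] at hi
      interval_cases i <;> simp [returnRule, Rule.op] at hs
      rw [h, hs]
  refine find?_eq_some_of_unique ?_ (decide_eq_true ((happ _).2 hq)) ?_
  · exact List.mem_append_right _ (List.mem_append_left _ (List.mem_map.2 ⟨r, hr, rfl⟩))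
  · intro b hb hab
    have hab := of_decide_eq_true hab
    rcases List.mem_append.1 hb with hb | hb
    · obtain ⟨p, hp, hb⟩ := List.mem_flatMap.1 hb
      obtain ⟨s, -, rfl⟩ := List.mem_map.1 hb
      have := hab.1
      simp only [serviceRule] at this
      have := List.mem_range.1 hp
      omega
    · rcases List.mem_append.1 hb with hb | hb
      · obtain ⟨q, -, rfl⟩ := List.mem_map.1 hb
        rw [← (happ _).1 hab, hq]
      · obtain ⟨q, -, rfl⟩ := List.mem_map.1 hb
        have := hab.1
        simp only [fetchRule] at this
        omega

/-! ### The visible part of the simulated run -/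

/-- In state `2` a digit `0` loops, the period accepts, and every other key leads to the trap state
`4`, from which nothing is accepted. -/
theorem scan_two {m β : Move} :
    scan 2 m = some β ↔ ∃ k, m = List.replicate k (digitKey 0) ++ dotKey :: β := by
  induction m with
  | nil => simp [scan]
  | cons c m ih =>
    by_cases h0 : c = digitKey 0
    · subst h0
      have : scan 2 (digitKey 0 :: m) = scan 2 m := by
        have hr : recognize 2 ((digitKey 0).val + 1) = 2 := by decide
        simp only [scan, hr]
        simp
      rw [this, ih]
      constructor
      · rintro ⟨k, rfl⟩
        exact ⟨k + 1, by simp [List.replicate_succ]⟩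
      · rintro ⟨k, hk⟩
        cases k with
        | zero =>
          simp only [List.replicate_zero, List.nil_append, List.cons.injEq] at hk
          exact absurd hk.1 (by decide)
        | succ k =>
          simp only [List.replicate_succ, List.cons_append, List.cons.injEq, true_and] at hk
          exact ⟨k, hk⟩
    · have hne : c.val + 1 ≠ 17 := by
        intro h
        apply h0
        apply Fin.ext
        change c.val = 16
        omega
      by_cases h1 : c = dotKey
      · subst h1
        have : scan 2 (dotKey :: m) = some m := by
          have hr : recognize 2 (dotKey.val + 1) = 3 := by decide
          simp only [scan, hr, scan_three]
          simp
        rw [this]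
        constructor
        · rintro ⟨⟩
          exact ⟨0, rfl⟩
        · rintro ⟨k, hk⟩
          cases k with
          | zero => simpa using hk
          | succ k =>
            simp only [List.replicate_succ, List.cons_append, List.cons.injEq] at hk
            exact absurd hk.1 h0
      · have hne' : c.val + 1 ≠ 15 := by
          intro h
          apply h1
          apply Fin.ext
          change c.val = 14
          omega
        have h4 : ∀ m, scan 4 m = none := by
          intro m
          induction m with
          | nil => rfl
          | cons k m ih => simp [scan, recognize, ih]
        have : scan 2 (c :: m) = none := by
          simp [scan, recognize, hne, hne', h4]
        rw [this]
        constructor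
        · simp
        · rintro ⟨k, hk⟩
          cases k with
          | zero =>
            simp only [List.replicate_zero, List.nil_append, List.cons.injEq] at hk
            exact absurd hk.1 h1
          | succ k =>
            simp only [List.replicate_succ, List.cons_append, List.cons.injEq] at hk
            exact absurd hk.1 h0

theorem scan_zero {m β : Move} : scan 0 m = some β ↔ ∃ k, m = zeroMove k β := by
  have h4 : ∀ m, scan 4 m = none := by
    intro m
    induction m with
    | nil => rfl
    | cons k m ih => simp [scan, recognize, ih]
  rcases m with _ | ⟨c, m⟩
  · simp [scan, zeroMove]
  · by_cases hc : c = digitKey 1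
    · subst hc
      rcases m with _ | ⟨c, m⟩
      · have : recognize 0 ((digitKey 1).val + 1) = 1 := by decide
        simp [scan, this, zeroMove]
      · by_cases hc : c = semicolonKey
        · subst hc
          have : scan 0 (digitKey 1 :: semicolonKey :: m) = scan 2 m := by
            have hr : recognize 0 ((digitKey 1).val + 1) = 1 := by decide
            have hr' : recognize 1 (semicolonKey.val + 1) = 2 := by decide
            simp only [scan, hr, hr']
            simp
          rw [this, scan_two]
          simp [zeroMove]
        · have h1 : recognize 0 ((digitKey 1).val + 1) = 1 := by decide
          have hne : c.val + 1 ≠ 28 := by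
            intro h
            apply hc
            apply Fin.ext
            change c.val = 27
            omega
          have h2 : recognize 1 (c.val + 1) = 4 := by simp [recognize, hne]
          simp [scan, h1, h2, h4, zeroMove, hc]
    · have hne : c.val + 1 ≠ 18 := by
        intro h
        apply hc
        apply Fin.ext
        change c.val = 17
        omega
      have h2 : recognize 0 (c.val + 1) = 4 := by simp [recognize, hne]
      simp [scan, h2, h4, zeroMove, hc]

theorem visible_zeroMove (p : Player) (n : ℕ) (α : Move) :
    visible (p, zeroMove n α) = some (p, α) := by
  unfold visible
  rw [scan_zero.2 ⟨n, rfl⟩]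
  rfl

theorem filterMap_visible_env (n : ℕ) (env : List Move) :
    (env.map fun α => (Player.bot, zeroMove n α)).filterMap visible
      = env.map fun α => (Player.bot, α) := by
  induction env with
  | nil => rfl
  | cons α env ih => simp [visible_zeroMove, ih]

/-- This restores the clause `real` of the invariant after the simulator has made its moves. -/
theorem bot_not_mem_visible_topMoves (ms : List Move) :
    RunSym.label .bot ∉ text ((topMoves ms).filterMap visible) := by
  intro h
  obtain ⟨x, hx, h⟩ := List.mem_flatMap.1 h
  obtain ⟨y, hy, hxy⟩ := List.mem_filterMap.1 hx
  obtain ⟨m, -, rfl⟩ := List.mem_map.1 hy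
  obtain ⟨β, -, rfl⟩ := Option.map_eq_some_iff.1 hxy
  simp at h

/-! ### Bounds -/

/-- The keys of bits differ from the period, so the first period after `1;` shows where `w` ends. -/
theorem threadMove_injective {w w' : List Bool} {α α' : Move}
    (h : threadMove w α = threadMove w' α') : w = w' ∧ α = α' := by
  have h : bitKeys w ++ dotKey :: α = bitKeys w' ++ dotKey :: α' := by
    simpa [threadMove] using h
  induction w generalizing w' with
  | nil =>
    cases w' with
    | nil => simpa [bitKeys] using h
    | cons b w' =>
      simp only [bitKeys, List.map_nil, List.nil_append, List.map_cons, List.cons_append,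
        List.cons.injEq] at h
      cases b <;> exact absurd h.1 (by decide)
  | cons a w ih =>
    cases w' with
    | nil =>
      simp only [bitKeys, List.map_nil, List.nil_append, List.map_cons, List.cons_append,
        List.cons.injEq] at h
      cases a <;> exact absurd h.1 (by decide)
    | cons b w' =>
      simp only [bitKeys, List.map_cons, List.cons_append, List.cons.injEq] at h
      have hab : a = b := by
        cases a <;> cases b <;> first | rfl | exact absurd h.1 (by decide)
      obtain ⟨rfl, rfl⟩ := ih (w' := w') (by simp [threadMove, bitKeys, h.2]) h.2
      exact ⟨by rw [hab], rfl⟩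

/-- This crude estimate is enough, because it is the length of a whole move that is bounded by the
number of cycles. -/
theorem length_threadMove (w : List Bool) (α : Move) :
    w.length ≤ (threadMove w α).length := by
  simp only [threadMove, bitKeys, List.length_append, List.length_map]
  omega

theorem ThreadBound.mono {n n' : ℕ} {Φ : Position} (h : ThreadBound n Φ) (hn : n ≤ n') :
    ThreadBound n' Φ := fun x hx w α hw => (h x hx w α hw).trans hn

theorem ThreadBound.append {n : ℕ} {Φ Ψ : Position} (h : ThreadBound n Φ)
    (h' : ThreadBound n Ψ) : ThreadBound n (Φ ++ Ψ) := by
  intro x hx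
  rcases List.mem_append.1 hx with hx | hx
  · exact h x hx
  · exact h' x hx

theorem threadBound_env (n : ℕ) (env : List Move) :
    ThreadBound n (env.map fun α => (Player.bot, zeroMove n α)) := by
  intro x hx w α hw
  obtain ⟨β, -, rfl⟩ := List.mem_map.1 hx
  rw [zeroMove_eq] at hw
  rw [← (threadMove_injective hw).1]
  simp

theorem threadBound_topMoves {n : ℕ} {ms : List Move} (h : ∀ m ∈ ms, m.length ≤ n) :
    ThreadBound n (topMoves ms) := by
  intro x hx w α hw
  obtain ⟨m, hm, rfl⟩ := List.mem_map.1 hx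
  have := h m hm
  rw [show m = threadMove w α from hw] at this
  exact (length_threadMove w α).trans this

theorem WellTimed.append_bot {Φ : Position} (h : WellTimed Φ) {n : ℕ} (hn : ThreadBound n Φ)
    (α : Move) : WellTimed (Φ ++ [(Player.bot, zeroMove n α)]) := by
  intro Ψ m hm
  rcases List.prefix_concat_iff.1 hm with hm | hm
  · have h1 := List.append_inj' hm rfl
    have h2 : m = zeroMove n α := by simpa using h1.2
    exact ⟨n, α, h2, h1.1 ▸ hn⟩
  · exact h Ψ m hm

theorem WellTimed.append_top {Φ : Position} (h : WellTimed Φ) (ms : List Move) :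
    WellTimed (Φ ++ topMoves ms) := by
  induction ms using List.reverseRecOn with
  | nil => simpa [topMoves] using h
  | append_singleton ms m ih =>
    intro Ψ m' hm
    have : Φ ++ topMoves (ms ++ [m]) = (Φ ++ topMoves ms) ++ [(Player.top, m)] := by
      simp [topMoves]
    rw [this] at hm
    rcases List.prefix_concat_iff.1 hm with hm | hm
    · obtain ⟨-, hm⟩ := List.append_inj' hm rfl
      simp at hm
    · exact ih Ψ m' hm

/-! ### Preservation of the invariant through a cycle, and its start. -/

theorem fetchAction_cases (κ : Kind) (a : Action) :
    fetchAction κ a = .idle ∨ fetchAction κ a = .permit := by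
  unfold fetchAction; split_ifs <;> simp

/-- A step of a machine that does not make a move. -/
theorem Machine.next_of_quiet {M : Machine} {e : Valuation} {C : Config} {r : Rule}
    (hr : M.rule? e C = some r) (ha : r.action = .idle ∨ r.action = .permit) (env : List Move) :
    M.next e C env = { Machine.applyRule r C with
      run := C.run ++ env.map fun α => (Player.bot, α) } := by
  have hact : M.act e C = r.action := by
    unfold Machine.act; rw [hr]; rfl
  unfold Machine.next Machine.made
  rw [hr, hact]
  rcases ha with ha | ha <;> simp [ha, applyAction]

/-- The effect of a step is split as in the simulation: the tapes and heads are the business of the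
fetch rule, the prepared moves and the run also that of the service routine. -/
theorem Machine.next_eq {M : Machine} {e : Valuation} {C : Config} {r : Rule}
    (hr : M.rule? e C = some r) (env : List Move) :
    M.next e C env = { Machine.applyRule r C with
      typed := (Machine.applyAction M.kind r.action C).typed
      block := (Machine.applyAction M.kind r.action C).block
      run := C.run ++ (env.map fun α => (Player.bot, α)) ++
        topMoves (madeMoves M.kind r.action C) } := by
  have hact : M.act e C = r.action := by
    unfold Machine.act; rw [hr]; rfl
  unfold Machine.next Machine.made
  rw [hr, hact]
  rcases ha : r.action with _ | k | _ | _ | _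
  · simp [applyAction, madeMoves, topMoves, applyRule]
  · simp [applyAction, madeMoves, topMoves, applyRule]
  · by_cases hk : M.kind = .bmepm <;> simp [applyAction, madeMoves, topMoves, applyRule, hk]
  · simp [applyAction, madeMoves, topMoves, applyRule]
  · simp [applyAction, madeMoves, topMoves, applyRule]

theorem update_unary (n : ℕ) :
    Function.update (Service.unary n) (n + 1) 1 = Service.unary (n + 1) := by
  funext j
  unfold Service.unary
  by_cases hj : j = n + 1
  · subst hj; simp
  · rw [Function.update_of_ne hj]
    split_ifs <;> first | rfl | omega

/-- One cycle of the simulated machine. -/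
theorem Simulates.cycle {M : Machine} {e : Valuation} {n : ℕ} {C : Config} {r : Rule}
    {B : ℕ → Config} {t : ℕ} (h : Simulates M.kind n C (B t)) (hr : M.rule? e C = some r)
    (hB : M.simulator.IsBranch e B) :
    (M.kind = .hpm ∨ M.Grants e C → M.simulator.Grants e (B t)) ∧
      ∃ env, M.EnvAllowed e C env ∧
        ∃ t' > t, Simulates M.kind (n + 1) (M.next e C env) (B t') := by
  set S := M.simulator
  have hact : M.act e C = r.action := by
    unfold Machine.act; rw [hr]; rfl
  have hSr : S.rule? e (B t) = some (fetchRule M.kind r) := by rw [h.rule?, hr]; rfl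
  have hSact : S.act e (B t) = fetchAction M.kind r.action := by
    unfold Machine.act; rw [hSr]; rfl
  have hgr : S.Grants e (B t) ↔ M.kind = .hpm ∨ M.Grants e C := by
    unfold Machine.Grants
    rw [hSact, hact]
    unfold fetchAction
    split_ifs with h1
    · simpa using h1
    · simpa using h1
  refine ⟨hgr.2, ?_⟩
  obtain ⟨env, hal, hnext⟩ := hB.2 t
  have hal : env.length ≤ 1 ∧ (env ≠ [] → S.Grants e (B t)) := hal
  -- The fetch step increases the counter before the move of the environment is copied; hence `n +
  -- 1` zeros.
  refine ⟨env.map (zeroMove (n + 1)), ?_, ?_⟩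
  · unfold Machine.EnvAllowed
    rcases hk : M.kind with _ | _ | _
    · trivial
    · refine ⟨by simpa using hal.1, fun hne => ?_⟩
      rcases hgr.1 (hal.2 (by simpa using hne)) with h1 | h1
      · rw [hk] at h1; cases h1
      · exact h1
    · intro hne
      rcases hgr.1 (hal.2 (by simpa using hne)) with h1 | h1
      · rw [hk] at h1; cases h1
      · exact h1
  rw [Machine.next_of_quiet hSr (fetchAction_cases _ _)] at hnext
  obtain ⟨b, hmoves, hmh⟩ := h.moves
  obtain ⟨pre, skip, htext, hreal, hskip⟩ := h.real
  have hhead : (B (t + 1)).workHead 1 = (B (t + 1)).workHead 0 := by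
    rw [hnext]
    simp [Machine.applyRule, Rule.op, fetchRule, h.runHead, h.markHead]
  have hblock : (B (t + 1)).block = [] := by
    rw [hnext]
    simp [Machine.applyRule, h.block]
  set p := b + 1 + (blockCode C.block ++ moveCode C.typed).length with hp
  -- The configuration after the fetch step is brought into the form from which
  -- `Service.reaches_service` starts.
  have hc : Service.ofConfig (B (t + 1)) = { Service.ofConfig (B (t + 1)) with
      state := 1
      simRun := tape (textCode C.run), marks := Service.startMark
      runHead := r.runDir.shift C.runHead
      moves := Service.write ((B t).work 2) p (moveOp M.kind r.action).write
      moveHead := (moveOp M.kind r.action).dir.shift p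
      count := Service.unary (n + 1), countHead := n + 1 + 1
      realHead := pre.length, typed := []
      run := (B t).run ++ env.map fun α => (Player.bot, α) } := by
    rw [hnext]
    simp only [Service.ofConfig, Machine.applyRule, Rule.op, fetchRule, List.cons_append,
      List.getD_cons_zero, List.getD_cons_succ, h.simRun, h.marks, h.runHead, h.count,
      h.countHead, hmh, update_unary, h.typed, hreal, Dir.shift, Service.mk.injEq, true_and,
      and_true]
    cases (moveOp M.kind r.action).write <;> rfl
  obtain ⟨f', b', hf', hreach⟩ := Service.reaches_service M.kind r.action C h.simBlock
    (Service.ofConfig (B (t + 1))) ((B t).work 2) b (n + 1) (r.runDir.shift C.runHead) hmoves env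
    hal.1 (B t).run C.run pre skip htext hskip
  rw [← hc] at hreach
  obtain ⟨t1, ht1, hBt1⟩ := hB.eq_of_reaches hreach
    (Service.toConfig_ofConfig hhead hblock).symm
  have hret : S.rule? e (B t1) = some (returnRule r.next) := by
    apply Machine.rule?_return (List.mem_of_find?_eq_some hr)
    · rw [hBt1]; rfl
    · rw [hBt1]
      change (B (t + 1)).work 4 ((B (t + 1)).workHead 4) = r.next
      rw [hnext]
      simp [Machine.applyRule, Rule.op, fetchRule, Dir.shift]
  refine ⟨t1 + 1, by omega, ?_⟩
  obtain ⟨env2, hal2, hnext2⟩ := hB.2 t1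
  have henv2 : env2 = [] := by
    by_contra hne
    have hg : S.Grants e (B t1) := hal2.2 hne
    unfold Machine.Grants Machine.act at hg
    rw [hret] at hg
    simp [returnRule] at hg
  rw [Machine.next_of_quiet hret (.inl rfl), henv2] at hnext2
  have henvmap : (env.map (zeroMove (n + 1))).map (fun α => (Player.bot, α))
      = env.map fun α => (Player.bot, zeroMove (n + 1) α) := by simp
  rw [Machine.next_eq hr, henvmap]
  -- At most one key is typed in a cycle.
  have htyped : (Machine.applyAction M.kind r.action C).typed.length ≤ n + 1 := by
    have := h.typed_le
    unfold Machine.applyAction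
    split <;> (try split_ifs) <;> (try simp) <;> omega
  have hblk : ∀ m ∈ (Machine.applyAction M.kind r.action C).block, m.length ≤ n + 1 := by
    have h1 := h.typed_le
    have h2 : ∀ m ∈ C.block, m.length ≤ n + 1 := fun m hm => (h.block_le m hm).trans (by omega)
    unfold Machine.applyAction
    split <;> (try split_ifs) <;> try exact h2
    · intro m hm
      rcases List.mem_append.1 hm with hm | hm
      · exact h2 m hm
      · rw [List.mem_singleton.1 hm]; omega
    · simp
  have hmade : ∀ m ∈ madeMoves M.kind r.action C, m.length ≤ n + 1 := by
    have h1 := h.typed_le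
    unfold madeMoves
    split_ifs
    · exact fun m hm => (h.block_le m hm).trans (by omega)
    · intro m hm
      rw [List.mem_singleton.1 hm]; omega
    · simp
  have hsb : M.kind ≠ .bmepm → (Machine.applyAction M.kind r.action C).block = [] := by
    intro hk
    have := h.simBlock hk
    unfold Machine.applyAction
    split <;> simp [hk, this]
  -- The simulator is an easy-play machine, so there is at most one new move of the environment, and
  -- only the run before this cycle has to be compared with it.
  have hwt : WellTimed (C.run ++ env.map fun α => (Player.bot, zeroMove (n + 1) α)) := by
    match env, hal.1 with
    | [], _ => simpa using h.wellTimed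
    | [α], _ => exact h.wellTimed.append_bot (h.bound.mono (by omega)) α
  have hD : B (t1 + 1) = { Machine.applyRule (returnRule r.next) (B t1) with
      run := (B t1).run } := by
    rw [hnext2]; simp
  have hw4 : ∀ i, (B (t + 1)).work (i + 5) = (Machine.applyRule r C).work i := by
    intro i
    rw [hnext]
    simp only [Machine.applyRule, fetchRule_op, h.work, h.workHead]
  have hwh4 : ∀ i, (B (t + 1)).workHead (i + 5) = (Machine.applyRule r C).workHead i := by
    intro i
    rw [hnext]
    simp only [Machine.applyRule, fetchRule_op, h.workHead]
  have hvh : (B (t + 1)).valHead = (Machine.applyRule r C).valHead := by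
    rw [hnext]
    simp only [Machine.applyRule, h.valHead]
    rfl
  have hrun : (B t1).run = (B t).run ++ (env.map fun α => (Player.bot, α)) ++
      (topMoves (madeMoves M.kind r.action C)).filterMap visible := by rw [hBt1]; rfl
  have hrun2 : (B (t1 + 1)).run = (B t1).run := by rw [hD]
  refine
    { state := by rw [hD]; rfl
      work := fun i => by rw [← hw4, hD, hBt1]; rfl
      workHead := fun i => by rw [← hwh4, hD, hBt1]; rfl
      valHead := by
        change _ = (Machine.applyRule r C).valHead
        rw [← hvh, hD, hBt1]; rfl
      simRun := by rw [hD, hBt1]; rfl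
      runHead := by rw [hD, hBt1]; rfl
      marks := by rw [hD, hBt1]; rfl
      markHead := by rw [hD, hBt1]; rfl
      moves := ⟨b', by rw [hD, hBt1]; exact hf', by rw [hD, hBt1]; rfl⟩
      count := by rw [hD, hBt1]; rfl
      countHead := by rw [hD, hBt1]; rfl
      -- The real run head stops right after the move of the environment; the moves made afterwards
      -- by the simulator are left for the next `reaches_skip`.
      real := ⟨text ((B t).run ++ env.map fun α => (Player.bot, α)),
        text ((topMoves (madeMoves M.kind r.action C)).filterMap visible), ?_, ?_,
        bot_not_mem_visible_topMoves _⟩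
      typed := by rw [hD, hBt1]; rfl
      block := by rw [hD, hBt1]; rfl
      run := ?_
      simBlock := hsb
      typed_le := htyped
      block_le := hblk
      bound := ((h.bound.mono (by omega)).append (threadBound_env _ _)).append
        (threadBound_topMoves hmade)
      wellTimed := hwt.append_top _ }
  · rw [hrun2, hrun, text_append]
  · rw [hD, hBt1]; rfl
  · rw [hrun2, hrun, h.run]
    simp only [List.filterMap_append, filterMap_visible_env]

/-- The simulation starts. -/
theorem Simulates.start {M : Machine} (h0 : ∃ r ∈ M.table, r.next = 0) {e : Valuation}
    {B : ℕ → Config} (hB : M.simulator.IsBranch e B) :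
    Simulates M.kind 0 Config.init (B 2) := by
  set c : Service := Service.ofConfig Config.init
  have hsym : c.sym = 0 := rfl
  have hready : c.Ready := ⟨by decide, by
    rw [hsym]; exact show 0 < if src 0 = 4 then 98 else 102 by decide⟩
  have hB0 : B 0 = c.toConfig Config.init := by
    rw [hB.1, Service.toConfig_ofConfig rfl rfl]
  have hB1 : B 1 = c.step.toConfig Config.init := by
    obtain ⟨env, hal, hnext⟩ := hB.2 0
    rw [hB0] at hal hnext
    have henv : env = [] := by
      by_contra hne
      exact Machine.not_grants_service hready (hal.2 hne)
    rw [hnext, henv, Machine.next_service hready]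
  -- The blank on work tape `4` reads as `0`, the start state of `M`. The return rule for it exists
  -- only if some rule of the table leads to state `0`.
  obtain ⟨r, hr, hr0⟩ := h0
  have hret : M.simulator.rule? e (B 1) = some (returnRule 0) := by
    rw [← hr0]
    apply Machine.rule?_return hr
    · rw [hB1]; rfl
    · rw [hB1, hr0]; rfl
  obtain ⟨env2, hal2, hnext2⟩ := hB.2 1
  have henv2 : env2 = [] := by
    by_contra hne
    have hg : M.simulator.Grants e (B 1) := hal2.2 hne
    unfold Machine.Grants Machine.act at hg
    rw [hret] at hg
    simp [returnRule] at hg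
  rw [Machine.next_of_quiet hret (.inl rfl), henv2] at hnext2
  have hD : B 2 = { Machine.applyRule (returnRule 0) (B 1) with
      run := (B 1).run } := by
    rw [hnext2]; simp
  have hrun : (B 2).run = [] := by rw [hD, hB1]; rfl
  refine
    { state := by rw [hD]; rfl
      work := fun i => by rw [hD, hB1]; rfl
      workHead := fun i => by rw [hD, hB1]; rfl
      valHead := by rw [hD, hB1]; rfl
      simRun := by rw [hD, hB1]; rfl
      runHead := by rw [hD, hB1]; rfl
      marks := ?_
      markHead := by rw [hD, hB1]; rfl
      moves := ⟨0, ?_, by rw [hD, hB1]; rfl⟩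
      count := ?_
      countHead := by rw [hD, hB1]; rfl
      real := ⟨[], [], by rw [hrun]; rfl, by rw [hD, hB1]; rfl, by simp⟩
      typed := by rw [hD, hB1]; rfl
      block := by rw [hD, hB1]; rfl
      run := by rw [hrun]; rfl
      simBlock := fun _ => rfl
      typed_le := le_rfl
      block_le := by simp [Config.init]
      bound := by intro x hx; simp [Config.init] at hx
      wellTimed := by
        intro Ψ m hm
        simp [Config.init] at hm }
  · rw [hD, hB1]
    change Function.update (fun _ => 0) 0 1 = _
    funext j
    unfold Service.startMark
    by_cases hj : j = 0
    · subst hj; simp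
    · simp [hj]
  · rw [hD, hB1]
    change Spells (Function.update (fun _ => 0) 0 99) 0 [99]
    intro j
    by_cases hj : j = 0
    · subst hj; simp
    · rw [Function.update_of_ne (by omega), List.getD_eq_default _ _ (by simp; omega)]
  · rw [hD, hB1]
    change Function.update (fun _ => 0) 0 2 = _
    funext j
    unfold Service.unary
    by_cases hj : j = 0
    · subst hj; simp
    · simp [hj]

/-! ### Limits -/

theorem listLimit_congr {α : Type*} {c d : ℕ → List α} (hc : ∀ {m n}, m ≤ n → c m <+: c n)
    (hd : ∀ {m n}, m ≤ n → d m <+: d n) (hcd : ∀ t, ∃ s, c t <+: d s)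
    (hdc : ∀ t, ∃ s, d t <+: c s) : listLimit c = listLimit d := by
  apply Stream'.Seq.ext
  intro n
  by_cases h : ∃ t, n < (c t).length
  · obtain ⟨t, ht⟩ := h
    obtain ⟨s, hs⟩ := hcd t
    rw [listLimit_get? hc ht, listLimit_get? hd (ht.trans_le hs.length_le)]
    obtain ⟨r, hr⟩ := hs
    rw [← hr, List.getElem?_append_left ht]
  · push Not at h
    rw [listLimit_get?_none h, listLimit_get?_none]
    intro t
    obtain ⟨s, hs⟩ := hdc t
    exact hs.length_le.trans (h s)

theorem listLimit_comp {α : Type*} {c : ℕ → List α} (hc : ∀ {m n}, m ≤ n → c m <+: c n)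
    {τ : ℕ → ℕ} (hτ : StrictMono τ) : listLimit (fun n => c (τ n)) = listLimit c :=
  listLimit_congr (fun h => hc (hτ.monotone h)) hc (fun t => ⟨τ t, List.prefix_rfl⟩)
    fun t => ⟨t, hc hτ.le_apply⟩

/-- Together with `listLimit_comp` this passes from `Simulates.run`, which holds at the ends of
cycles, to the complete runs. -/
theorem filterMap_listLimit (f : LabMove → Option LabMove) {c : ℕ → Position}
    (hc : ∀ {m n}, m ≤ n → c m <+: c n) :
    filterMap f (listLimit c) = listLimit fun n => (c n).filterMap f := by
  refine listLimit_congr (filterMap_mono f _) (fun h => (hc h).filterMap f) ?_ ?_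
  · intro n
    obtain ⟨t, ht⟩ := exists_take_listLimit hc n
    refine ⟨t, ?_⟩
    rw [ht]
    exact (List.take_prefix _ _).filterMap f
  · intro t
    refine ⟨(c t).length, ?_⟩
    rw [take_listLimit hc]

/-! ### Threads of the cirquent `F♣` -/

theorem numeral_one : numeral 1 = [digitKey 1] := by
  simp [numeral]

theorem cirquentPrefix_one (w : Fin 1 → List Bool) (α : Move) :
    cirquentPrefix 1 w ++ α = threadMove (w 0) α := by
  simp [cirquentPrefix, numeral_one, threadMove, List.intercalate]

/-- The reduction of the labmoves of a run to the thread `x`. -/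
noncomputable def thread (x : Fin 1 → InfBits) (y : LabMove) : Option LabMove :=
  (stripPrefix (cirquentThread 1 x) y.2).map fun β => (y.1, β)

/-- The choice made in `stripPrefix` is harmless: by `threadMove_injective` the remainder `β` is
unique. -/
theorem stripPrefix_thread {x : Fin 1 → InfBits} {m β : Move} :
    stripPrefix (cirquentThread 1 x) m = some β ↔
      ∃ w, IsInitial w (x 0) ∧ m = threadMove w β := by
  have hiff : ∀ β, (∃ p ∈ cirquentThread 1 x, m = p ++ β) ↔
      ∃ w, IsInitial w (x 0) ∧ m = threadMove w β := by
    intro β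
    constructor
    · rintro ⟨_, ⟨w, hw, rfl⟩, rfl⟩
      exact ⟨w 0, hw 0, cirquentPrefix_one w β⟩
    · rintro ⟨w, hw, rfl⟩
      refine ⟨_, ⟨fun _ => w, fun j => ?_, rfl⟩, (cirquentPrefix_one (fun _ => w) β).symm⟩
      rw [Subsingleton.elim j 0]
      exact hw
  rw [← hiff]
  unfold stripPrefix
  constructor
  · intro h
    split_ifs at h with hex
    obtain rfl := Option.some.inj h
    exact hex.choose_spec
  · intro h
    have hex : ∃ β, ∃ p ∈ cirquentThread 1 x, m = p ++ β := ⟨β, h⟩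
    rw [dif_pos hex]
    obtain ⟨w, -, hw⟩ := (hiff _).1 hex.choose_spec
    obtain ⟨w', -, hw'⟩ := (hiff _).1 h
    rw [hw] at hw'
    rw [(threadMove_injective hw').2]

/-- The initial segments of `000…` are the strings of zeros, which are just what the recognizer
admits between `1;` and the period. -/
theorem thread_zero (y : LabMove) : thread (fun _ _ => false) y = visible y := by
  unfold thread visible
  congr 1
  ext β
  rw [stripPrefix_thread, scan_zero]
  constructor
  · rintro ⟨w, hw, h⟩
    refine ⟨w.length, ?_⟩
    rw [zeroMove_eq, h]
    congr 1
    exact List.eq_replicate_iff.2 ⟨rfl, fun b hb => by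
      obtain ⟨i, hi, rfl⟩ := List.getElem_of_mem hb
      exact hw i hi⟩
  · rintro ⟨k, hk⟩
    exact ⟨List.replicate k false, fun i hi => by simp, hk.trans (zeroMove_eq k β)⟩

/-- Since `x 0` and `000…` agree in the first `k` places, a bitstring of length at most `k` is an
initial segment of both or of neither. -/
theorem thread_eq_visible {x : Fin 1 → InfBits} {k : ℕ}
    (hx : IsInitial (List.replicate k false) (x 0)) {y : LabMove}
    (hy : ∀ w α, y.2 = threadMove w α → w.length ≤ k) : thread x y = visible y := by
  rw [← thread_zero]
  unfold thread
  congr 1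
  ext β
  rw [stripPrefix_thread, stripPrefix_thread]
  refine exists_congr fun w => and_congr_left fun hw =>
    forall_congr' fun i => forall_congr' fun h => ?_
  have hi : i < (List.replicate k false).length := by
    rw [List.length_replicate]
    exact h.trans_le (hy w β hw)
  have := hx i hi
  rw [List.getElem_replicate] at this
  rw [← this]

/-- The game `F♣` in terms of threads. -/
theorem club_legal {Atom : Type*} {F : Formula Atom} {I : ConstInterp Atom} {Γ : Run} :
    Γ ∈ F.club.legalRuns I ↔ AllMoves (fun m => ∃ w α, m = threadMove w α) Γ ∧
      ∀ x, filterMap (thread x) Γ ∈ (F.interp I).Lr := by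
  constructor
  · rintro ⟨h1, h2⟩
    refine ⟨fun n y hy => ?_, fun x => h2 (⟨0, Nat.one_pos⟩, x)⟩
    obtain ⟨a, w, α, -, hm⟩ := h1 n y hy
    have ha : a.val = 0 := Nat.lt_one_iff.1 a.2
    refine ⟨w ⟨0, Nat.one_pos⟩, α, ?_⟩
    rw [hm, ha]
    exact cirquentPrefix_one w α
  · rintro ⟨h1, h2⟩
    refine ⟨fun n y hy => ?_, fun ax => ?_⟩
    · obtain ⟨w, α, hm⟩ := h1 n y hy
      refine ⟨⟨0, Nat.one_pos⟩, fun _ => w, α, fun j hj => ?_, ?_⟩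
      · exact absurd (Finset.mem_singleton.2 rfl) hj
      · rw [hm]
        exact (cirquentPrefix_one (fun _ => w) α).symm
    · obtain ⟨a, x⟩ := ax
      have ha : a.val = 0 := Nat.lt_one_iff.1 a.2
      have := h2 x
      simp only [ha]
      exact this

/-! ### From well-timed runs of `F♣` to runs of `F`. -/

theorem take_succ_of_get? {α : Type*} {s : Stream'.Seq α} {n : ℕ} {a : α}
    (h : s.get? n = some a) : s.take (n + 1) = s.take n ++ [a] := by
  have hlen : (s.take n).length = n := by
    apply le_antisymm (Stream'.Seq.length_take_le)
    by_contra hlt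
    push Not at hlt
    have h1 := getElem?_take s n (s.take n).length
    rw [if_pos hlt] at h1
    simp only [List.getElem?_length] at h1
    rw [Stream'.Seq.le_stable s hlt.le h1.symm] at h
    cases h
  apply List.ext_getElem?
  intro i
  rw [getElem?_take, List.getElem?_append, hlen, getElem?_take]
  rcases lt_trichotomy i n with hi | hi | hi
  · rw [if_pos (by omega), if_pos hi, if_pos hi]
  · subst hi; simp [h]
  · rw [if_neg (by omega), if_neg (by omega), eq_comm, List.getElem?_eq_none_iff]
    simp; omega

theorem take_succ_of_get?_none {α : Type*} {s : Stream'.Seq α} {n : ℕ}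
    (h : s.get? n = none) : s.take (n + 1) = s.take n := by
  apply List.ext_getElem?
  intro i
  rw [getElem?_take, getElem?_take]
  rcases lt_trichotomy i n with hi | hi | hi
  · rw [if_pos (by omega), if_pos hi]
  · subst hi; simp [h]
  · rw [if_neg (by omega), if_neg (by omega)]

/-- The shortest illegal initial segment is nonempty, as the empty run is legal, and its last move
exists, as otherwise a shorter segment would be the same. -/
theorem LegalSet.exists_illegalBy {L : Set Run} (hL : LegalSet L) {Γ : Run} (h : Γ ∉ L) :
    ∃ p, IllegalBy L p Γ := by
  classical
  rw [hL.iff_take] at h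
  push Not at h
  have hmin := fun m (hm : m < Nat.find h) => not_not.1 (Nat.find_min h hm)
  have hspec := Nat.find_spec h
  rcases hn : Nat.find h with _ | n
  · rw [hn] at hspec
    refine absurd ((hL.iff_take (Position.toRun [])).2 ?_) hspec
    intro k
    exfalso
    apply hspec
    rw [hL]
    intro n hn
    rw [toRun_take] at hn
    simp at hn
  · rw [hn] at hspec hmin
    rcases hg : Γ.get? n with _ | ⟨p, α⟩
    · rw [take_succ_of_get?_none hg] at hspec
      exact absurd (hmin n (by omega)) hspec
    · exact ⟨p, n, α, hg, hspec, fun m hm => hmin m (by omega)⟩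

theorem WellTimed.prefix {Φ Ψ : Position} (h : WellTimed Φ) (hp : Ψ <+: Φ) : WellTimed Ψ :=
  fun Ξ m hm => h Ξ m (hm.trans hp)

/-- The illegal move `1;0…0.α` affects only threads that begin with its `k` zeros, and by
`WellTimed` these coincide with `000…` on everything earlier. So the offence is visible in the
thread that is really played. -/
theorem club_illegal {Atom : Type*} {F : Formula Atom} {I : ConstInterp Atom} {Γ : Run}
    (hΓ : ∀ n, WellTimed (Γ.take n)) (h : IllegalBy (F.club.legalRuns I) .bot Γ) :
    (F.interp I).Illegal .bot (filterMap visible Γ) := by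
  set A := F.interp I
  obtain ⟨n, m, hget, hnot, hle⟩ := h
  have htake := take_succ_of_get? hget
  obtain ⟨k, α, rfl, hk⟩ := hΓ (n + 1) (Γ.take n) m (by rw [htake])
  have hn := club_legal.1 (hle n le_rfl)
  -- The offending move has the required form, so the illegality must come from one of the threads.
  have hnot' : ¬ ∀ x, filterMap (thread x) (Position.toRun (Γ.take (n + 1))) ∈ A.Lr := by
    intro hx
    refine hnot (club_legal.2 ⟨fun i y hy => ?_, hx⟩)
    rw [htake, toRun_get?, List.getElem?_append] at hy
    split_ifs at hy with hi
    · exact hn.1 i y (by rw [toRun_get?]; exact hy)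
    · have : y = (Player.bot, zeroMove k α) := by
        have := List.mem_of_getElem? hy
        simpa using this
      exact ⟨_, α, by rw [this]; exact zeroMove_eq k α⟩
  push Not at hnot'
  obtain ⟨x, hx⟩ := hnot'
  have hleg : Position.toRun ((Γ.take n).filterMap visible) ∈ A.Lr := by
    have := hn.2 fun _ _ => false
    rw [filterMap_toRun] at this
    rwa [show thread (fun _ _ => false) = visible from funext thread_zero] at this
  have hleg_x := hn.2 x
  rw [filterMap_toRun] at hx hleg_x
  rw [htake, List.filterMap_append] at hx
  by_cases hini : IsInitial (List.replicate k false) (x 0)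
  swap
  -- If `x 0` does not begin with `k` zeros, the move does not occur in the thread `x`, which is
  -- then no different from the legal thread before it.
  · have : thread x (Player.bot, zeroMove k α) = none := by
      unfold thread
      rw [Option.map_eq_none_iff, Option.eq_none_iff_forall_ne_some]
      intro β hβ
      obtain ⟨w, hw, he⟩ := stripPrefix_thread.1 hβ
      rw [zeroMove_eq] at he
      rw [← (threadMove_injective he).1] at hw
      exact hini hw
    simp [this] at hx
    exact absurd hleg_x hx
  have hcongr : (Γ.take n).filterMap (thread x) = (Γ.take n).filterMap visible :=
    List.filterMap_congr fun y hy => thread_eq_visible hini (hk y hy)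
  have hlast : thread x (Player.bot, zeroMove k α) = some (Player.bot, α) := by
    unfold thread
    rw [(stripPrefix_thread (β := α)).2 ⟨_, hini, zeroMove_eq k α⟩]
    rfl
  rw [hcongr, List.filterMap_cons, hlast] at hx
  simp only [List.filterMap_nil] at hx
  have hsucc : (Γ.take (n + 1)).filterMap visible
      = (Γ.take n).filterMap visible ++ [(Player.bot, α)] := by
    rw [htake, List.filterMap_append]
    simp [visible_zeroMove]
  set j := ((Γ.take n).filterMap visible).length with hj
  have hjs : ((Γ.take (n + 1)).filterMap visible).length = j + 1 := by
    rw [hsucc]; simp [hj]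
  have ht1 : (filterMap visible Γ).take j = (Γ.take n).filterMap visible :=
    take_listLimit (filterMap_mono visible Γ) n
  have ht2 : (filterMap visible Γ).take (j + 1) = (Γ.take (n + 1)).filterMap visible := by
    rw [← hjs]
    exact take_listLimit (filterMap_mono visible Γ) (n + 1)
  refine ⟨j, α, ?_, ?_, ?_⟩
  · have := listLimit_get? (filterMap_mono visible Γ) (t := n + 1) (n := j) (by rw [hjs]; omega)
    rw [hsucc] at this
    rw [filterMap, this]
    simp [hj]
  · rw [ht2, hsucc]
    exact hx
  -- Initial segments of length at most `j` precede the offending move, and up to it the thread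
  -- `000…` is legal.
  · intro i hi
    have h1 := (A.legal.iff_take _).1 hleg i
    rw [toRun_take, ← ht1] at h1
    have h2 : ((filterMap visible Γ).take j).take i = (filterMap visible Γ).take i := by
      apply List.ext_getElem?
      intro q
      rw [List.getElem?_take, getElem?_take, getElem?_take]
      split_ifs <;> first | rfl | omega
    rwa [h2] at h1

/-- A legal run is won in all threads, hence in `000…`. An illegal run won by the machine is illegal
by the environment, and `club_illegal` makes the visible run illegal by the environment as well. -/
theorem club_win {Atom : Type*} {F : Formula Atom} {I : ConstInterp Atom} {Γ : Run}
    (hΓ : ∀ n, WellTimed (Γ.take n)) (h : (F.club.interp I).Wn Γ = .top) :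
    (F.interp I).Wn (filterMap visible Γ) = .top := by
  have hL : LegalSet (F.club.legalRuns I) := (F.club.interp I).legal
  by_cases hleg : Γ ∈ F.club.legalRuns I
  · unfold Cirquent.interp ConstGame.ofLegal at h
    simp only [hleg, if_true] at h
    split_ifs at h with hW
    obtain ⟨a, -, ha⟩ := hW ⟨0, Nat.one_pos⟩ fun _ _ => false
    have ha0 : a.val = 0 := Nat.lt_one_iff.1 a.2
    rw [ha0] at ha
    have : filterMap (thread fun _ _ => false) Γ = filterMap visible Γ := by
      rw [show thread (fun _ _ => false) = visible from funext thread_zero]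
    rw [← this]
    exact ha
  · obtain ⟨p, hp⟩ := hL.exists_illegalBy hleg
    cases p with
    | top =>
      have := (F.club.interp I).illegal_lost .top Γ hp
      rw [h] at this
      cases this
    | bot => exact (F.interp I).illegal_lost .bot _ (club_illegal hΓ hp)

/-! ### Machines that do not halt -/

/-- The states that can occur in computations. -/
def Machine.Visits (M : Machine) (q : ℕ) : Prop := q = 0 ∨ ∃ r ∈ M.table, r.next = q

/-- The idle rules stand behind the table of `M`, so they come into play only where `M` has halted.
Several of them may apply, but those for the same state are equal. -/
theorem Machine.rule?_total (M : Machine) {e : Valuation} {C : Config} (hC : M.Visits C.state) :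
    M.total.rule? e C = some ((M.rule? e C).getD (idleRule C.state)) := by
  unfold Machine.rule? Machine.total
  rw [List.find?_append]
  rcases hf : M.table.find? fun r => decide (r.Applies e C) with _ | r
  · rw [hf, Option.none_or]
    refine find?_eq_some_of_unique ?_ ?_ ?_
    · rcases hC with h | ⟨r, hr, h⟩
      · simp [h]
      · exact List.mem_cons_of_mem _ (List.mem_map.2 ⟨r, hr, by rw [h]; rfl⟩)
    · refine decide_eq_true ⟨rfl, ?_, ?_, ?_⟩ <;> simp [idleRule]
    · intro b hb hab
      have hst : b.state = C.state := (of_decide_eq_true hab).1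
      rcases List.mem_cons.1 hb with rfl | hb
      · simp only [Option.getD_none, ← hst]; rfl
      · obtain ⟨r, -, rfl⟩ := List.mem_map.1 hb
        simp only [Option.getD_none, ← hst]; rfl
  · rw [hf]; rfl

theorem Machine.act_total (M : Machine) {e : Valuation} {C : Config} (hC : M.Visits C.state) :
    M.total.act e C = M.act e C := by
  unfold Machine.act
  rw [M.rule?_total hC]
  cases M.rule? e C <;> rfl

theorem Machine.next_total (M : Machine) {e : Valuation} {C : Config} (hC : M.Visits C.state)
    (env : List Move) : M.total.next e C env = M.next e C env := by
  have hmade : M.total.made e C = M.made e C := by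
    unfold Machine.made; rw [M.act_total hC]; rfl
  unfold Machine.next
  rw [hmade, M.act_total hC, M.rule?_total hC]
  rcases hr : M.rule? e C with _ | r
  · have : applyRule (idleRule C.state) C = C := rfl
    simp only [Option.getD_none, this]
    rfl
  · rfl

theorem Machine.state_next (M : Machine) (e : Valuation) (C : Config) (env : List Move) :
    (M.next e C env).state = ((M.rule? e C).map Rule.next).getD C.state := by
  have h : ∀ κ a C, (applyAction κ a C).state = C.state := by
    intro κ a C
    unfold applyAction
    split <;> (try split_ifs) <;> rfl
  unfold Machine.next
  simp only [h]
  cases M.rule? e C <;> rfl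

theorem Machine.Visits.next {M : Machine} {e : Valuation} {C : Config} (hC : M.Visits C.state)
    (env : List Move) : M.Visits (M.next e C env).state := by
  rw [Machine.state_next]
  rcases hr : M.rule? e C with _ | r
  · exact hC
  · exact .inr ⟨r, List.mem_of_find?_eq_some hr, rfl⟩

theorem Machine.envAllowed_total (M : Machine) {e : Valuation} {C : Config}
    (hC : M.Visits C.state) (env : List Move) :
    M.total.EnvAllowed e C env ↔ M.EnvAllowed e C env := by
  unfold Machine.EnvAllowed Machine.Grants
  rw [M.act_total hC]
  rfl

/-! ### The branch of the simulated machine -/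

theorem Machine.IsBranch.run_prefix {M : Machine} {e : Valuation} {B : ℕ → Config}
    (hB : M.IsBranch e B) {m n : ℕ} (h : m ≤ n) : (B m).run <+: (B n).run := by
  induction h with
  | refl => exact List.prefix_rfl
  | step _ ih =>
    obtain ⟨env, -, hn⟩ := hB.2 _
    refine ih.trans ?_
    rw [hn]
    unfold Machine.next
    rw [List.append_assoc]
    exact List.prefix_append _ _

/-- The step of the simulation for a machine that may halt. -/
theorem Simulates.cycle_total {M : Machine} {e : Valuation} {n : ℕ} {C : Config}
    {B : ℕ → Config} {t : ℕ} (h : Simulates M.kind n C (B t)) (hC : M.Visits C.state)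
    (hB : M.total.simulator.IsBranch e B) :
    (M.kind = .hpm ∨ M.Grants e C → M.total.simulator.Grants e (B t)) ∧
      ∃ C', M.Succ e C C' ∧ M.Visits C'.state ∧ ∃ t' > t, Simulates M.kind (n + 1) C' (B t') := by
  have h' : Simulates M.total.kind n C (B t) := h
  obtain ⟨hg, env, hal, t', ht', hsim⟩ := h'.cycle (M.rule?_total hC) hB
  rw [M.envAllowed_total hC] at hal
  rw [M.next_total hC] at hsim
  refine ⟨?_, _, ⟨env, hal, rfl⟩, hC.next env, t', ht', hsim⟩
  unfold Machine.Grants at hg ⊢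
  rw [M.act_total hC] at hg
  exact hg

/-- A branch of the simulator comes from a branch of the simulated machine. -/
theorem Machine.IsBranch.exists_simulated {M : Machine} {e : Valuation} {B : ℕ → Config}
    (hB : M.total.simulator.IsBranch e B) :
    ∃ (B' : ℕ → Config) (τ : ℕ → ℕ), M.IsBranch e B' ∧ StrictMono τ ∧
      (∀ n, Simulates M.kind n (B' n) (B (τ n))) ∧
      ∀ n, M.kind = .hpm ∨ M.Grants e (B' n) → M.total.simulator.Grants e (B (τ n)) := by
  -- `Machine.Visits` has to be part of the induction hypothesis, because `M.total` has idle rules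
  -- only for such states.
  let P : ℕ → Config × ℕ → Prop := fun n x =>
    Simulates M.kind n x.1 (B x.2) ∧ M.Visits x.1.state
  have hstep : ∀ n x, P n x → ∃ y, P (n + 1) y ∧ M.Succ e x.1 y.1 ∧ x.2 < y.2 := by
    rintro n ⟨C, t⟩ ⟨hs, hv⟩
    obtain ⟨-, C', hsucc, hv', t', ht', hs'⟩ := hs.cycle_total hv hB
    exact ⟨(C', t'), ⟨hs', hv'⟩, hsucc, ht'⟩
  choose! f hf using hstep
  -- The first two steps of the simulator put the markers and enter state `32`; the simulation
  -- starts at time `2`.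
  let g : ℕ → Config × ℕ := fun n => Nat.rec (Config.init, 2) (fun n x => f n x) n
  have hg : ∀ n, P n (g n) := by
    intro n
    induction n with
    | zero =>
      exact ⟨Simulates.start (M := M.total)
        ⟨idleRule 0, List.mem_append_right _ (List.mem_cons_self ..), rfl⟩ hB, .inl rfl⟩
    | succ n ih => exact (hf n _ ih).1
  refine ⟨fun n => (g n).1, fun n => (g n).2, ⟨rfl, fun n => (hf n _ (hg n)).2.1⟩,
    strictMono_nat_of_lt_succ fun n => (hf n _ (hg n)).2.2, fun n => (hg n).1, fun n => ?_⟩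
  exact ((hg n).1.cycle_total (hg n).2 hB).1

/-! ### Victory of the simulator. -/

theorem Machine.Wins.simulator {Atom : Type*} {M : Machine} {F : Formula Atom}
    {I : ConstInterp Atom} (h : M.Wins (F.club.interp I).toGame) :
    M.total.simulator.Wins (F.interp I).toGame := by
  intro e B hB
  obtain ⟨B', τ, hB', hτ, hsim, hgrant⟩ := hB.exists_simulated
  obtain ⟨hwin, hfair⟩ := h e B' hB'
  -- A run is determined by any cofinal sequence of its positions, so it is enough to compare the
  -- two at the times `τ n`.
  have hrun : runSpelled B = filterMap visible (runSpelled B') := by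
    unfold runSpelled
    rw [filterMap_listLimit _ hB'.run_prefix, ← listLimit_comp hB.run_prefix hτ]
    congr 1
    funext n
    exact (hsim n).run
  have hwt : ∀ n, WellTimed ((runSpelled B').take n) := by
    intro n
    obtain ⟨t, ht⟩ := exists_take_listLimit hB'.run_prefix n
    unfold runSpelled
    rw [ht]
    exact (hsim t).wellTimed.prefix (List.take_prefix _ _)
  rw [hrun]
  refine ⟨club_win hwt hwin, fun _ => ?_⟩
  by_cases hk : M.kind = .hpm
  -- For a hard-play machine permission is granted at the start of every cycle, and `N ≤ τ N`.
  · exact .inl fun N => ⟨τ N, hτ.le_apply, hgrant N (.inl hk)⟩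
  · rcases hfair hk with hf | hf
    · left
      intro N
      obtain ⟨t, ht, hg⟩ := hf N
      exact ⟨τ t, ht.trans hτ.le_apply, hgrant t (.inr hg)⟩
    -- If `M` is excused from fairness by an offence of the environment, the same offence in the
    -- real run excuses the simulator.
    · exact .inr (club_illegal hwt hf)

end CoL

theorem lemma9p2 (Atom : Type*) :
    ∃ g : CoL.Machine → CoL.Machine, Computable g ∧
      ∀ (M : CoL.Machine) (F : CoL.Formula Atom) (I : CoL.ConstInterp Atom),
        M.Wins (F.club.interp I).toGame → (g M).Wins (F.interp I).toGame :=
  ⟨fun M => M.total.simulator,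
    (CoL.Machine.primrec_simulator.comp CoL.Machine.primrec_total).to_comp,
    fun _ _ _ h => h.simulator⟩
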